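/- For a positive integer $n$ let $\|n\|$ (its integer complexity) be the least number of $1$'s needed to write $n$ using addition and multiplication, and let $\delta(n)=\|n\|-3\log_3 n$ be its defect. Call $n$ stable if $\|3^k n\|=3k+\|n\|$ for all $k\ge 0$. For every $n$ some $3^k n$ is stable; for any such $k$ put $\|n\|_{\mathrm{st}}=\|3^k n\|-3k$ and $\delta_{\mathrm{st}}(n)=\delta(3^k n)$ (these do not depend on the choice of $k$). The set of low-defect pairs $(f,C)$, with $f$ a polynomial in variables $x_1,\dots,x_d$ for some $d\ge 0$ and $C$ a positive integer, is the smallest set such that: (1) if $m$ is a positive integer and $C\ge\|m\|$, then $(m,C)$ is a low-defect pair, where $m$ is the constant polynomial (with $d=0$); (2) if $(f_1,C_1)$ and $(f_2,C_2)$ are low-defect pairs with $f_i$ in $d_i$ variables, then so is $\bigl(f_1(x_1,\dots,x_{d_1})\,f_2(x_{d_1+1},\dots,x_{d_1+d_2}),\,C_1+C_2\bigr)$; (3) if $(f,C)$ is a low-defect pair with $f$ in $d$ variables, $c$ is a positive integer and $D\ge\|c\|$, then $(f\cdot x_{d+1}+c,\,C+D)$ is a low-defect pair. If $(f,C)$ is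 a low-defect pair for some $C$, then $f$ is called a low-defect polynomial, and $\|f\|$ denotes the smallest such $C$. The number of variables of a low-defect polynomial $f$ equals its degree $k$; its leading coefficient $a$ is the coefficient of $x_1\cdots x_k$. Call $f$ substantial if $\|f\|=\|a\|_{\mathrm{st}}+\deg f$. For $(n_1,\dots,n_k)\in\mathbb{Z}_{\ge 0}^k$ put $$\delta_f(n_1,\dots,n_k)=\|f\|+3(n_1+\cdots+n_k)-3\log_3 f(3^{n_1},\dots,3^{n_k}).$$ The exceptional set of $f$ is $$S=\{(n_1,\dots,n_k)\in\mathbb{Z}_{\ge0}^k:\ \|f(3^{n_1},\dots,3^{n_k})\|_{\mathrm{st}}<\|f\|+3(n_1+\cdots+n_k)\}.$$ Proposition. Let $f$ be a substantial low-defect polynomial of degree $k$, with exceptional set $S$. Then each of the following three sets of real numbers is well-ordered, with order type less than $\omega^k$: $$\delta_f(S),\qquad \{\delta_{\mathrm{st}}(f(3^{n_1},\dots,3^{n_k})):(n_1,\dots,n_k)\in S\},\qquad \{\delta(f(3^{n_1},\dots,3^{n_k})):(n_1,\dots,n_k)\in S\}.$$ -/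

import Mathlib

/-- Formal expressions built from `1` using addition and multiplication. -/
inductive OneExpr : Type
  | one : OneExpr
  | add : OneExpr → OneExpr → OneExpr
  | mul : OneExpr → OneExpr → OneExpr

/-- The natural number an expression evaluates to. -/
def OneExpr.val : OneExpr → ℕ
  | .one => 1
  | .add a b => a.val + b.val
  | .mul a b => a.val * b.val

/-- The number of `1`s used in an expression. -/
def OneExpr.ones : OneExpr → ℕ
  | .one => 1
  | .add a b => a.ones + b.ones
  | .mul a b => a.ones + b.ones

/-- The integer complexity `‖n‖` of a positive integer `n`: the least number of `1`s needed to
write `n` using addition and multiplication. -/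
noncomputable def cpx (n : ℕ) : ℕ :=
  sInf {m | ∃ e : OneExpr, e.val = n ∧ e.ones = m}

/-- The defect `δ(n) = ‖n‖ - 3 log₃ n`. -/
noncomputable def defect (n : ℕ) : ℝ :=
  (cpx n : ℝ) - 3 * Real.logb 3 (n : ℝ)

/-- `n` is stable if `‖3^k n‖ = 3k + ‖n‖` for every `k ≥ 0`. -/
def IsStable (n : ℕ) : Prop :=
  ∀ k : ℕ, cpx (3 ^ k * n) = 3 * k + cpx n

/-- The smallest `k` such that `3^k n` is stable. -/
noncomputable def stabIndex (n : ℕ) : ℕ :=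
  sInf {k | IsStable (3 ^ k * n)}

/-- The stable complexity `‖n‖_st = ‖3^k n‖ - 3k`, where `3^k n` is stable; this does not depend
on the choice of such a `k`, and the smallest one is used here. -/
noncomputable def cpxSt (n : ℕ) : ℤ :=
  (cpx (3 ^ stabIndex n * n) : ℤ) - 3 * (stabIndex n : ℤ)

/-- The stable defect `δ_st(n) = δ(3^k n)`, where `3^k n` is stable. -/
noncomputable def defectSt (n : ℕ) : ℝ :=
  defect (3 ^ stabIndex n * n)

/-- `LowDefectPair d f C`: the polynomial `f` in the `d` variables `x_0, …, x_{d-1}` forms a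
low-defect pair with base complexity `C`. All polynomials arising have nonnegative integer
coefficients, so they are taken in `ℕ[x_0, …, x_{d-1}]`. In `tensor`, the variables of the second
factor are relabelled to follow those of the first; in `tensorX`, a new last variable is used. -/
inductive LowDefectPair : (d : ℕ) → MvPolynomial (Fin d) ℕ → ℕ → Prop
  | const (m C : ℕ) (hm : 0 < m) (hC : cpx m ≤ C) :
      LowDefectPair 0 (MvPolynomial.C m) C
  | tensor (d₁ d₂ : ℕ) (f₁ : MvPolynomial (Fin d₁) ℕ) (f₂ : MvPolynomial (Fin d₂) ℕ) (C₁ C₂ : ℕ)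
      (h₁ : LowDefectPair d₁ f₁ C₁) (h₂ : LowDefectPair d₂ f₂ C₂) :
      LowDefectPair (d₁ + d₂)
        (MvPolynomial.rename (Fin.castAdd d₂) f₁ * MvPolynomial.rename (Fin.natAdd d₁) f₂)
        (C₁ + C₂)
  | tensorX (d : ℕ) (f : MvPolynomial (Fin d) ℕ) (C c D : ℕ)
      (h : LowDefectPair d f C) (hc : 0 < c) (hD : cpx c ≤ D) :
      LowDefectPair (d + 1)
        (MvPolynomial.rename Fin.castSucc f * MvPolynomial.X (Fin.last d) + MvPolynomial.C c)
        (C + D)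

/-- Low-defect polynomials in `d` variables. -/
def IsLowDefectPoly {d : ℕ} (f : MvPolynomial (Fin d) ℕ) : Prop :=
  ∃ C : ℕ, LowDefectPair d f C

/-- The absolute base complexity `‖f‖`: the smallest `C` such that `(f, C)` is a low-defect
pair. -/
noncomputable def polyCpx {d : ℕ} (f : MvPolynomial (Fin d) ℕ) : ℕ :=
  sInf {C | LowDefectPair d f C}

/-- The leading coefficient of a low-defect polynomial in `d` variables: the coefficient of the
product of all its variables. -/
noncomputable def leadCoeff {d : ℕ} (f : MvPolynomial (Fin d) ℕ) : ℕ :=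
  MvPolynomial.coeff (Finsupp.equivFunOnFinite.symm (fun _ : Fin d => 1)) f

/-- The value `f(3^{n_1}, …, 3^{n_d})`. -/
noncomputable def evalPowThree {d : ℕ} (f : MvPolynomial (Fin d) ℕ) (n : Fin d → ℕ) : ℕ :=
  MvPolynomial.eval (fun i => 3 ^ n i) f

/-- `f` is a substantial low-defect polynomial: `‖f‖ = ‖a‖_st + deg f`, with `a` the leading
coefficient of `f`. -/
def IsSubstantial {d : ℕ} (f : MvPolynomial (Fin d) ℕ) : Prop :=
  IsLowDefectPoly f ∧ (polyCpx f : ℤ) = cpxSt (leadCoeff f) + (f.totalDegree : ℤ)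

/-- `δ_f(n_1, …, n_d) = ‖f‖ + 3(n_1 + ⋯ + n_d) - 3 log₃ f(3^{n_1}, …, 3^{n_d})`. -/
noncomputable def polyDefect {d : ℕ} (f : MvPolynomial (Fin d) ℕ) (n : Fin d → ℕ) : ℝ :=
  (polyCpx f : ℝ) + 3 * ((∑ i, n i : ℕ) : ℝ) - 3 * Real.logb 3 (evalPowThree f n : ℝ)

/-- The exceptional set of `f`: those `(n_1, …, n_d)` for which the stable complexity of
`f(3^{n_1}, …, 3^{n_d})` is less than `‖f‖ + 3(n_1 + ⋯ + n_d)`. -/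
def exceptionalSet {d : ℕ} (f : MvPolynomial (Fin d) ℕ) : Set (Fin d → ℕ) :=
  {n | cpxSt (evalPowThree f n) < (polyCpx f : ℤ) + 3 * ((∑ i, n i : ℕ) : ℤ)}

/-- The set `A` of reals is well-ordered, and its order type is less than `α`. -/
def OrderTypeLT (A : Set ℝ) (α : Ordinal.{0}) : Prop :=
  ∃ _ : IsWellOrder A (fun x y => x < y), Ordinal.type (fun x y : A => x < y) < α

theorem totalDegree_rename_of_inj {σ τ : Type*} {g : σ → τ} (hg : Function.Injective g)
    (p : MvPolynomial σ ℕ) : (MvPolynomial.rename g p).totalDegree = p.totalDegree := by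
  classical
  rw [MvPolynomial.totalDegree_eq, MvPolynomial.totalDegree_eq,
    MvPolynomial.support_rename_of_injective hg, Finset.sup_image]
  congr 1
  funext m
  simp [Finsupp.sum_mapDomain_index, id]
  rfl

/-- A low-defect polynomial in `d` variables is nonzero and has degree `d`. -/
theorem LowDefectPair.ne_zero_and_totalDegree {d : ℕ} {f : MvPolynomial (Fin d) ℕ} {C : ℕ}
    (h : LowDefectPair d f C) : f ≠ 0 ∧ f.totalDegree = d := by
  induction h with
  | const m C hm hC =>
    exact ⟨by simpa using hm.ne', MvPolynomial.totalDegree_C m⟩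
  | tensor d₁ d₂ f₁ f₂ C₁ C₂ h₁ h₂ ih₁ ih₂ =>
    have e₁ : MvPolynomial.rename (Fin.castAdd d₂) f₁ ≠ 0 := fun h0 => ih₁.1
      (MvPolynomial.rename_injective _ (Fin.castAdd_injective d₁ d₂) (h0.trans (map_zero _).symm))
    have e₂ : MvPolynomial.rename (Fin.natAdd d₁) f₂ ≠ 0 := fun h0 => ih₂.1
      (MvPolynomial.rename_injective _ (Fin.natAdd_injective d₂ d₁) (h0.trans (map_zero _).symm))
    refine ⟨mul_ne_zero e₁ e₂, ?_⟩
    rw [MvPolynomial.totalDegree_mul_of_isDomain e₁ e₂,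
      totalDegree_rename_of_inj (Fin.castAdd_injective d₁ d₂),
      totalDegree_rename_of_inj (Fin.natAdd_injective d₂ d₁), ih₁.2, ih₂.2]
  | tensorX d f C c D h hc hD ih =>
    have e₁ : MvPolynomial.rename Fin.castSucc f ≠ 0 := fun h0 => ih.1
      (MvPolynomial.rename_injective _ (Fin.castSucc_injective d) (h0.trans (map_zero _).symm))
    have e₂ : (MvPolynomial.X (Fin.last d) : MvPolynomial (Fin (d + 1)) ℕ) ≠ 0 :=
      MvPolynomial.X_ne_zero _
    have e : (MvPolynomial.rename Fin.castSucc f * MvPolynomial.X (Fin.last d) +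
        MvPolynomial.C c).totalDegree = d + 1 := by
      rw [MvPolynomial.totalDegree_add_eq_left_of_totalDegree_lt] <;>
        rw [MvPolynomial.totalDegree_mul_of_isDomain e₁ e₂,
          totalDegree_rename_of_inj (Fin.castSucc_injective d), ih.2,
          MvPolynomial.totalDegree_X]
      rw [MvPolynomial.totalDegree_C]
      exact Nat.succ_pos d
    refine ⟨fun h0 => ?_, e⟩
    rw [h0] at e
    simp at e

/-! Suppose `δ_f(S)` had order type at least `ω^k`. On `S` the gap `j = δ_f(n) - δ_st(f(3^n))` is a
positive integer, bounded because `δ_f` is bounded and stable defects are nonnegative. So the stable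
defects involved are bounded, and numbers of bounded defect are efficiently represented by finitely
many low-defect pairs `(g, C)` (`finitelyCovered_defectBelow`). Since `ω^k` survives finite
partitions, a single `j ≥ 1` and a single `g` satisfy `δ_g(m) + j = δ_f(n)` on a set of values that
is still of type at least `ω^k`.

Defect functions are monotone, so such a set of values needs at least `k` coordinates going to
infinity (`OmegaPowLarge.le_card`): all `k` for `f`, and some set `J` with `|J| ≥ k` for `g`, the
other coordinates being fixed. Comparing suprema (`isLUB_pairDefect`) gives `‖f‖ - 3 log₃ a = C' - 3
log₃ b + j`, where `b` is the leading coefficient of `g` on `J` and `C'` is `C` plus the cost of the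
fixed coordinates. Every free variable costs at least one `1` outside `b`, so `C' ≥ ‖b‖ + |J| ≥
‖b‖_st + k`. As `3 log₃(a/b)` is an integer, `a/b` is a power of `3` and `δ_st(a) = δ_st(b)`. Hence
`k = ‖f‖ - ‖a‖_st = C' - ‖b‖_st + j ≥ k + j`, which is absurd.

The other two sets arise from `δ_f` by subtracting bounded nonnegative integers, so a further finite
partition and a translation reduce them to the first. -/

/-! ### Sets of reals of order type at least `ω ^ k`. -/

/-- `OmegaPowLarge k A` says, for a well-ordered set `A` of reals, that `A` has order type at least
`ω ^ k`, phrased through increasing sequences of intervals. -/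
def OmegaPowLarge : ℕ → Set ℝ → Prop
  | 0, A => A.Nonempty
  | k + 1, A => ∃ t : ℕ → ℝ, StrictMono t ∧ ∀ i, OmegaPowLarge k (A ∩ Set.Ico (t i) (t (i + 1)))

namespace OmegaPowLarge

theorem mono {k : ℕ} {A B : Set ℝ} (hAB : A ⊆ B) (h : OmegaPowLarge k A) : OmegaPowLarge k B := by
  induction k generalizing A B with
  | zero => exact Set.Nonempty.mono hAB h
  | succ k ih =>
    obtain ⟨t, ht, h⟩ := h
    exact ⟨t, ht, fun i => ih (Set.inter_subset_inter_left _ hAB) (h i)⟩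

theorem nonempty {k : ℕ} {A : Set ℝ} (h : OmegaPowLarge k A) : A.Nonempty := by
  induction k generalizing A with
  | zero => exact h
  | succ k ih =>
    obtain ⟨t, ht, h⟩ := h
    exact (ih (h 0)).mono Set.inter_subset_left

/-- Merging the intervals between consecutive good indices only enlarges them. -/
theorem subsequence {k : ℕ} {A : Set ℝ} {t : ℕ → ℝ} (ht : StrictMono t)
    (h : ∃ᶠ i in Filter.atTop, OmegaPowLarge k (A ∩ Set.Ico (t i) (t (i + 1)))) :
    OmegaPowLarge (k + 1) A := by
  obtain ⟨φ, hφ, hφ'⟩ := Filter.extraction_of_frequently_atTop h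
  refine ⟨t ∘ φ, ht.comp hφ, fun i => (hφ' i).mono ?_⟩
  refine Set.inter_subset_inter_right _ (Set.Ico_subset_Ico le_rfl (ht.monotone ?_))
  exact hφ (Nat.lt_succ_self i)

/-- Additive indecomposability of `ω ^ k`: one of the two parts is large in infinitely many of the
intervals. This is the pigeonhole principle behind every later thinning. -/
theorem union {k : ℕ} {A B : Set ℝ} (h : OmegaPowLarge k (A ∪ B)) :
    OmegaPowLarge k A ∨ OmegaPowLarge k B := by
  induction k generalizing A B with
  | zero => exact Set.union_nonempty.1 h
  | succ k ih =>
    obtain ⟨t, ht, h⟩ := h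
    have h' : ∃ᶠ i in Filter.atTop, (OmegaPowLarge k (A ∩ Set.Ico (t i) (t (i + 1))) ∨
        OmegaPowLarge k (B ∩ Set.Ico (t i) (t (i + 1)))) :=
      (Filter.Eventually.of_forall fun i => ih (by
        rw [← Set.union_inter_distrib_right]; exact h i)).frequently
    exact (Filter.frequently_or_distrib.1 h').imp (subsequence ht) (subsequence ht)

theorem exists_of_biUnion {ι : Type*} {k : ℕ} {s : Set ι} (hs : s.Finite) {A : ι → Set ℝ}
    (h : OmegaPowLarge k (⋃ i ∈ s, A i)) : ∃ i ∈ s, OmegaPowLarge k (A i) := by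
  induction s, hs using Set.Finite.induction_on with
  | empty => simpa using h.nonempty
  | insert _ _ ih =>
    rw [Set.biUnion_insert] at h
    rcases h.union with h | h
    · exact ⟨_, Set.mem_insert _ _, h⟩
    · obtain ⟨i, hi, h⟩ := ih h
      exact ⟨i, Set.mem_insert_of_mem _ hi, h⟩

theorem exists_color {α ι : Type*} {k : ℕ} {φ : α → ℝ} {X : Set α} {s : Set ι} (hs : s.Finite)
    (P : ι → α → Prop) (hP : ∀ x ∈ X, ∃ i ∈ s, P i x) (h : OmegaPowLarge k (φ '' X)) :
    ∃ i ∈ s, OmegaPowLarge k (φ '' {x ∈ X | P i x}) := by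
  refine exists_of_biUnion hs (h.mono ?_)
  rintro _ ⟨x, hx, rfl⟩
  obtain ⟨i, hi, hx'⟩ := hP x hx
  exact Set.mem_biUnion hi ⟨x, ⟨hx, hx'⟩, rfl⟩

theorem image_add {k : ℕ} {A : Set ℝ} (s : ℝ) (h : OmegaPowLarge k A) :
    OmegaPowLarge k ((· + s) '' A) := by
  induction k generalizing A with
  | zero => exact Set.Nonempty.image _ h
  | succ k ih =>
    obtain ⟨t, ht, h⟩ := h
    refine ⟨fun i => t i + s, fun i j hij => add_lt_add_left (ht hij) s, fun i => (ih (h i)).mono ?_⟩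
    rintro _ ⟨x, ⟨hx, h1, h2⟩, rfl⟩
    exact ⟨⟨x, hx, rfl⟩, by simpa using h1, by simpa using h2⟩

/-- `ω ^ (k + 1)` is a sequence of `ω` consecutive blocks of length `ω ^ k`, whose left ends give
the interval endpoints. The offset `β` lets the induction start at any block. -/
theorem of_strictMonoOn {k : ℕ} {A : Set ℝ} {β γ : Ordinal.{0}} {g : Ordinal.{0} → ℝ}
    (hg : StrictMonoOn g (Set.Iio γ)) (hβ : β + Ordinal.omega0 ^ (k : Ordinal.{0}) ≤ γ)
    (hA : ∀ o < Ordinal.omega0 ^ (k : Ordinal.{0}), g (β + o) ∈ A) : OmegaPowLarge k A := by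
  induction k generalizing A β with
  | zero => exact ⟨_, hA 0 (by simp)⟩
  | succ k ih =>
    set w := Ordinal.omega0 ^ (k : Ordinal.{0}) with hw
    have hw0 : 0 < w := Ordinal.opow_pos _ Ordinal.omega0_pos
    have hpow : Ordinal.omega0 ^ ((k + 1 : ℕ) : Ordinal.{0}) = w * Ordinal.omega0 := by
      rw [Nat.cast_succ, ← Order.succ_eq_add_one, Ordinal.opow_succ]
    rw [hpow] at hβ hA
    have hlt : ∀ i : ℕ, w * i < w * Ordinal.omega0 := fun i =>
      mul_lt_mul_of_pos_left (Ordinal.natCast_lt_omega0 i) hw0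
    have hsucc : ∀ i : ℕ, w * ((i + 1 : ℕ) : Ordinal.{0}) = w * i + w := fun i => by
      rw [Nat.cast_succ, mul_add, mul_one]
    have hmem : ∀ o < w * Ordinal.omega0, β + o ∈ Set.Iio γ := fun o ho =>
      lt_of_lt_of_le (by simpa using ho) hβ
    refine ⟨fun i => g (β + w * i), fun i j hij => hg (hmem _ (hlt i)) (hmem _ (hlt j)) ?_,
      fun i => ih (β := β + w * i) ?_ fun o ho => ?_⟩
    · have : w * (i : Ordinal.{0}) < w * j := mul_lt_mul_of_pos_left (by exact_mod_cast hij) hw0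
      simpa using this
    · rw [add_assoc, ← hsucc]
      exact le_trans (by simpa using (hlt (i + 1)).le) hβ
    · have ho' : w * i + o < w * ((i + 1 : ℕ) : Ordinal.{0}) := by
        rw [hsucc]; simpa using ho
      have ho'' := ho'.trans (hlt (i + 1))
      rw [add_assoc]
      refine ⟨hA _ ho'', ?_, hg (hmem _ ho'') (hmem _ (hlt (i + 1))) (by simpa using ho')⟩
      exact hg.monotoneOn (hmem _ (hlt i)) (hmem _ ho'') (by simp)

end OmegaPowLarge

theorem orderTypeLT_of_not_omegaPowLarge {k : ℕ} {A : Set ℝ} (hA : A.IsWF)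
    (h : ¬ OmegaPowLarge k A) : OrderTypeLT A (Ordinal.omega0 ^ (k : Ordinal.{0})) := by
  classical
  have hwf : WellFoundedLT A := ⟨hA⟩
  have hwo : IsWellOrder A (fun x y => x < y) := inferInstance
  refine ⟨hwo, lt_of_not_ge fun hle => h ?_⟩
  let r : A → A → Prop := fun x y => x < y
  let g : Ordinal.{0} → ℝ := fun o =>
    if ho : o < Ordinal.type r then (Ordinal.enum r ⟨o, ho⟩ : A) else 0
  have hg : StrictMonoOn g (Set.Iio (Ordinal.type r)) := by
    intro a ha b hb hab
    simp only [g, dif_pos (Set.mem_Iio.1 ha), dif_pos (Set.mem_Iio.1 hb)]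
    exact (Ordinal.enum_lt_enum (r := r) (o₁ := ⟨a, ha⟩) (o₂ := ⟨b, hb⟩)).2 hab
  refine OmegaPowLarge.of_strictMonoOn (β := 0) hg (by simpa using hle) fun o ho => ?_
  have ho' : 0 + o < Ordinal.type r := by simpa using lt_of_lt_of_le ho hle
  simp only [g, dif_pos ho']
  exact Subtype.coe_prop _

/-! ### Monotone functions on `ℕ ^ d`. -/

/-- The points of `X` take the fixed values `c` in all coordinates outside `J`. -/
def FixedOff {d : ℕ} (J : Finset (Fin d)) (c : Fin d → ℕ) (X : Set (Fin d → ℕ)) : Prop :=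
  ∀ n ∈ X, ∀ i ∉ J, n i = c i

/-- `X` has points all of whose coordinates in `J` are arbitrarily large. -/
def UnboundedOn {d : ℕ} (J : Finset (Fin d)) (X : Set (Fin d → ℕ)) : Prop :=
  ∀ M : ℕ, ∃ n ∈ X, ∀ i ∈ J, M ≤ n i

theorem FixedOff.erase {d : ℕ} {J : Finset (Fin d)} {c : Fin d → ℕ} {X : Set (Fin d → ℕ)}
    (hX : FixedOff J c X) (i : Fin d) (v : ℕ) :
    FixedOff (J.erase i) (Function.update c i v) {n ∈ X | n i = v} := by
  rintro n ⟨hn, hi⟩ l hl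
  rcases eq_or_ne l i with rfl | hli
  · simpa using hi
  · rw [Function.update_of_ne hli]
    exact hX n hn l fun h => hl (Finset.mem_erase.2 ⟨hli, h⟩)

theorem OmegaPowLarge.exists_slice {d k : ℕ} {φ : (Fin d → ℕ) → ℝ} {J : Finset (Fin d)}
    {X : Set (Fin d → ℕ)} (h : OmegaPowLarge k (φ '' X)) (M : Fin d → ℕ)
    (hM : ∀ n ∈ X, ∃ i ∈ J, n i < M i) :
    ∃ i ∈ J, ∃ v, OmegaPowLarge k (φ '' {n ∈ X | n i = v}) := by
  have hs : {p : (_ : Fin d) × ℕ | p ∈ J.sigma fun i => Finset.range (M i)}.Finite :=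
    Finset.finite_toSet _
  obtain ⟨⟨i, v⟩, hp, h⟩ := h.exists_color hs (fun p n => n p.1 = p.2) fun n hn => by
    obtain ⟨i, hi, hlt⟩ := hM n hn
    exact ⟨⟨i, n i⟩, by simpa using ⟨hi, hlt⟩, rfl⟩
  simp only [Set.mem_ofPred_eq, Finset.mem_sigma] at hp
  exact ⟨i, hp.1, v, h⟩

/-- Fix a point `p` with value in the second interval. Points with values in the first interval
cannot dominate `p`, so they lie in finitely many slices `n i = v` with `v < p i`, each with one
free coordinate fewer; one of these slices is still large. -/
theorem OmegaPowLarge.le_card {d k : ℕ} {φ : (Fin d → ℕ) → ℝ} (hφ : Monotone φ)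
    {J : Finset (Fin d)} {c : Fin d → ℕ} {X : Set (Fin d → ℕ)} (hX : FixedOff J c X)
    (h : OmegaPowLarge k (φ '' X)) : k ≤ J.card := by
  induction k generalizing J c X with
  | zero => exact Nat.zero_le _
  | succ k ih =>
    obtain ⟨t, ht, h⟩ := h
    obtain ⟨_, ⟨p, hp, rfl⟩, hp1, -⟩ := (h 1).nonempty
    have h0 : OmegaPowLarge k (φ '' {n ∈ X | φ n < t 1}) := (h 0).mono (by
      rintro _ ⟨⟨n, hn, rfl⟩, -, h2⟩
      exact ⟨n, ⟨hn, h2⟩, rfl⟩)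
    obtain ⟨i, hi, v, hv⟩ := h0.exists_slice (J := J) p (by
      rintro n ⟨hn, hlt⟩
      by_contra! hge
      refine absurd (hφ (a := p) (b := n) fun i => ?_) (not_le.2 (hlt.trans_le hp1))
      by_cases hi : i ∈ J
      · exact hge i hi
      · rw [hX n hn i hi, hX p hp i hi])
    have := ih (FixedOff.erase (fun n hn => hX n hn.1) i v) hv
    rw [Finset.card_erase_of_mem hi] at this
    have := Finset.card_pos.2 ⟨i, hi⟩
    omega

/-- If `M` witnesses that unboundedness fails, the slices `n i = v` with `i ∈ J` and `v < M` cover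
`X`; a large one is kept and `J` shrinks. -/
theorem OmegaPowLarge.exists_unboundedOn {d k : ℕ} {φ : (Fin d → ℕ) → ℝ}
    {J : Finset (Fin d)} {c : Fin d → ℕ} {X : Set (Fin d → ℕ)} (hX : FixedOff J c X)
    (h : OmegaPowLarge k (φ '' X)) :
    ∃ (J' : Finset (Fin d)) (c' : Fin d → ℕ) (X' : Set (Fin d → ℕ)), X' ⊆ X ∧
      FixedOff J' c' X' ∧ UnboundedOn J' X' ∧ OmegaPowLarge k (φ '' X') := by
  induction hJ : J.card generalizing J c X with
  | zero =>
    rw [Finset.card_eq_zero] at hJ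
    subst hJ
    obtain ⟨_, n, hn, rfl⟩ := h.nonempty
    exact ⟨∅, c, X, subset_rfl, hX, fun M => ⟨n, hn, by simp⟩, h⟩
  | succ m ih =>
    by_cases hU : UnboundedOn J X
    · exact ⟨J, c, X, subset_rfl, hX, hU, h⟩
    · simp only [UnboundedOn, not_forall, not_exists, not_and] at hU
      obtain ⟨M, hM⟩ := hU
      obtain ⟨i, hi, v, hv⟩ := h.exists_slice (J := J) (fun _ => M) (by
        intro n hn
        by_contra! hge
        obtain ⟨i, hi, h⟩ := hM n hn
        exact h (hge i hi))
      obtain ⟨J', c', X', hs, h'⟩ := ih (hX.erase i v) hv (by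
        rw [Finset.card_erase_of_mem hi, hJ]; rfl)
      exact ⟨J', c', X', hs.trans (Set.sep_subset _ _), h'⟩

/-! ### Integer complexity and the defect. -/

theorem OneExpr.val_pos (e : OneExpr) : 0 < e.val := by
  induction e with
  | one => exact one_pos
  | add a b iha ihb => exact Nat.add_pos_left iha _
  | mul a b iha ihb => exact Nat.mul_pos iha ihb

theorem exists_expr {n : ℕ} (hn : 0 < n) : ∃ e : OneExpr, e.val = n ∧ e.ones = cpx n := by
  have hne : {m | ∃ e : OneExpr, e.val = n ∧ e.ones = m}.Nonempty := by
    have : ∃ e : OneExpr, e.val = n := by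
      induction n, hn using Nat.le_induction with
      | base => exact ⟨.one, rfl⟩
      | succ n _ ih =>
        obtain ⟨e, he⟩ := ih
        exact ⟨.add e .one, by simp [OneExpr.val, he]⟩
    obtain ⟨e, he⟩ := this
    exact ⟨e.ones, e, he, rfl⟩
  exact Nat.sInf_mem hne

theorem cpx_val_le (e : OneExpr) : cpx e.val ≤ e.ones :=
  Nat.sInf_le ⟨e, rfl, rfl⟩

theorem cpx_add_le {a b : ℕ} (ha : 0 < a) (hb : 0 < b) : cpx (a + b) ≤ cpx a + cpx b := by
  obtain ⟨e, rfl, he⟩ := exists_expr ha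
  obtain ⟨e', rfl, he'⟩ := exists_expr hb
  rw [← he, ← he']
  exact cpx_val_le (.add e e')

theorem cpx_mul_le {a b : ℕ} (ha : 0 < a) (hb : 0 < b) : cpx (a * b) ≤ cpx a + cpx b := by
  obtain ⟨e, rfl, he⟩ := exists_expr ha
  obtain ⟨e', rfl, he'⟩ := exists_expr hb
  rw [← he, ← he']
  exact cpx_val_le (.mul e e')

theorem OneExpr.ones_pos (e : OneExpr) : 0 < e.ones := by
  induction e with
  | one => exact one_pos
  | add a b iha ihb => exact Nat.add_pos_left iha _
  | mul a b iha ihb => exact Nat.add_pos_left iha _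

theorem cpx_pos {n : ℕ} (hn : 0 < n) : 0 < cpx n := by
  obtain ⟨e, -, he⟩ := exists_expr hn
  exact he ▸ e.ones_pos

theorem cpx_three_le : cpx 3 ≤ 3 :=
  cpx_val_le (.add (.add .one .one) .one)

theorem cpx_three_pow_mul_le (k : ℕ) {n : ℕ} (hn : 0 < n) : cpx (3 ^ k * n) ≤ 3 * k + cpx n := by
  induction k with
  | zero => simp
  | succ k ih =>
    have h := cpx_mul_le (a := 3) (b := 3 ^ k * n) (by norm_num) (by positivity)
    rw [pow_succ', mul_assoc]
    have := cpx_three_le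
    omega

/-- A most efficient expression of `n` ends in an addition or in a multiplication of smaller
numbers, unless `n = 1`. -/
theorem cpx_cases {n : ℕ} (hn : 0 < n) : n = 1 ∨
    (∃ a b, 0 < b ∧ b ≤ a ∧ n = a + b ∧ cpx n = cpx a + cpx b) ∨
    (∃ u v, 0 < u ∧ 0 < v ∧ u < n ∧ v < n ∧ n = u * v ∧ cpx n = cpx u + cpx v) := by
  obtain ⟨e, he, hc⟩ := exists_expr hn
  cases e with
  | one => exact Or.inl he.symm
  | add a b =>
    right; left
    have h := cpx_add_le a.val_pos b.val_pos
    have h1 := cpx_val_le a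
    have h2 := cpx_val_le b
    simp only [OneExpr.val, OneExpr.ones] at he hc
    rw [he] at h
    rcases le_total b.val a.val with hab | hab
    · exact ⟨a.val, b.val, b.val_pos, hab, he.symm, by omega⟩
    · exact ⟨b.val, a.val, a.val_pos, hab, by omega, by omega⟩
  | mul a b =>
    right; right
    have h := cpx_mul_le a.val_pos b.val_pos
    have h1 := cpx_val_le a
    have h2 := cpx_val_le b
    simp only [OneExpr.val, OneExpr.ones] at he hc
    rw [he] at h
    have hc' : cpx n = cpx a.val + cpx b.val := by omega
    have ha := cpx_pos a.val_pos
    have hb := cpx_pos b.val_pos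
    refine ⟨a.val, b.val, a.val_pos, b.val_pos, ?_, ?_, he.symm, hc'⟩
    · refine lt_of_le_of_ne (he ▸ Nat.le_mul_of_pos_right _ b.val_pos) fun h => ?_
      rw [h] at hc'; omega
    · refine lt_of_le_of_ne (he ▸ Nat.le_mul_of_pos_left _ a.val_pos) fun h => ?_
      rw [h] at hc'; omega

/-- If both summands are at least `2`, the sum is at most the product, which costs the same. Only
the addition of `1` needs an estimate, namely `(x + 1)³ ≤ 3x³` for `x ≥ 3`, with `x = 1, 2` done by
hand. -/
theorem OneExpr.val_pow_three_le (e : OneExpr) : e.val ^ 3 ≤ 3 ^ e.ones := by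
  induction e with
  | one => norm_num [OneExpr.val, OneExpr.ones]
  | mul a b iha ihb =>
    simp only [OneExpr.val, OneExpr.ones, mul_pow, pow_add]
    exact Nat.mul_le_mul iha ihb
  | add a b iha ihb =>
    have aux : ∀ x i j : ℕ, 0 < x → 0 < i → 0 < j → x ^ 3 ≤ 3 ^ i →
        (x + 1) ^ 3 ≤ 3 ^ (i + j) := by
      intro x i j hx hi hj h
      have hj3 : 3 ≤ 3 ^ j := Nat.le_self_pow hj.ne' 3
      have hi3 : 3 ≤ 3 ^ i := Nat.le_self_pow hi.ne' 3
      rw [pow_add]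
      rcases (by omega : x = 1 ∨ x = 2 ∨ 3 ≤ x) with rfl | rfl | h3
      · nlinarith
      · have : 9 ≤ 3 ^ i := by
          have : i ≠ 1 := by rintro rfl; norm_num at h
          calc 9 = 3 ^ 2 := by norm_num
            _ ≤ 3 ^ i := Nat.pow_le_pow_right (by norm_num) (by omega)
        nlinarith
      · have h1 : (x + 1) ^ 3 ≤ x ^ 3 * 3 := by nlinarith [mul_le_mul h3 h3 (by norm_num) (by omega)]
        exact h1.trans (Nat.mul_le_mul h hj3)
    simp only [OneExpr.val, OneExpr.ones]
    have ha := a.val_pos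
    have hb := b.val_pos
    rcases (by omega : b.val = 1 ∨ a.val = 1 ∨ (2 ≤ a.val ∧ 2 ≤ b.val)) with h | h | ⟨h, h'⟩
    · rw [h]; exact aux _ _ _ ha a.ones_pos b.ones_pos iha
    · rw [h, add_comm, add_comm a.ones]; exact aux _ _ _ hb b.ones_pos a.ones_pos ihb
    · have h1 : a.val + b.val ≤ a.val * b.val := by nlinarith
      calc (a.val + b.val) ^ 3 ≤ (a.val * b.val) ^ 3 := Nat.pow_le_pow_left h1 3
        _ ≤ 3 ^ (a.ones + b.ones) := by rw [mul_pow, pow_add]; exact Nat.mul_le_mul iha ihb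

theorem pow_three_le_three_pow_cpx {n : ℕ} (hn : 0 < n) : n ^ 3 ≤ 3 ^ cpx n := by
  obtain ⟨e, rfl, hc⟩ := exists_expr hn
  exact hc ▸ e.val_pow_three_le

/-- `3 log₃ x`, the lower bound for the complexity of `x`. -/
noncomputable def logThree (n : ℕ) : ℝ := 3 * Real.logb 3 n

theorem logThree_mul {a b : ℕ} (ha : 0 < a) (hb : 0 < b) :
    logThree (a * b) = logThree a + logThree b := by
  simp only [logThree]
  rw [Nat.cast_mul, Real.logb_mul (by positivity) (by positivity), mul_add]

theorem logThree_three_pow (k : ℕ) : logThree (3 ^ k) = 3 * k := by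
  simp [logThree, Real.logb_pow]

theorem logThree_le {a b : ℕ} (ha : 0 < a) (h : a ≤ b) : logThree a ≤ logThree b := by
  have := Real.logb_le_logb_of_le (b := 3) (by norm_num) (by positivity : (0 : ℝ) < a)
    (by exact_mod_cast h : (a : ℝ) ≤ b)
  simp only [logThree]; linarith

theorem logThree_nonneg {n : ℕ} (hn : 0 < n) : 0 ≤ logThree n := by
  have := logThree_le one_pos hn
  simpa [logThree] using this

theorem logThree_pow {n : ℕ} (k : ℕ) : logThree (n ^ k) = k * logThree n := by
  simp only [logThree]
  rw [Nat.cast_pow, Real.logb_pow]; ring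

theorem logThree_inj {a b : ℕ} (ha : 0 < a) (hb : 0 < b) (h : logThree a = logThree b) :
    a = b := by
  simp only [logThree] at h
  have h' : Real.logb 3 a = Real.logb 3 b := by linarith
  have := Real.logb_injOn_pos (b := 3) (by norm_num) (Set.mem_Ioi.2 (by positivity))
    (Set.mem_Ioi.2 (by positivity)) h'
  exact_mod_cast this

theorem defect_eq (n : ℕ) : defect n = cpx n - logThree n := rfl

theorem logThree_le_cpx {n : ℕ} (hn : 0 < n) : logThree n ≤ cpx n := by
  have h := logThree_le (by positivity) (pow_three_le_three_pow_cpx hn)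
  rw [logThree_pow, logThree_three_pow] at h
  push_cast at h; linarith

theorem defect_nonneg {n : ℕ} (hn : 0 < n) : 0 ≤ defect n := by
  have := logThree_le_cpx hn
  rw [defect_eq]; linarith

theorem defect_mul {u v : ℕ} (hu : 0 < u) (hv : 0 < v) (h : cpx (u * v) = cpx u + cpx v) :
    defect (u * v) = defect u + defect v := by
  rw [defect_eq, defect_eq, defect_eq, logThree_mul hu hv, h]
  push_cast; ring

theorem eq_three_pow_of_defect_eq_zero {n : ℕ} (hn : 0 < n) (h : defect n = 0) :
    ∃ t, n = 3 ^ (t + 1) ∧ cpx n = 3 * (t + 1) := by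
  rw [defect_eq] at h
  have h3 : n ^ 3 = 3 ^ cpx n := by
    apply logThree_inj (by positivity) (by positivity)
    rw [logThree_pow, logThree_three_pow]; push_cast; linarith
  obtain ⟨s, -, rfl⟩ := (Nat.dvd_prime_pow Nat.prime_three).1 (h3 ▸ dvd_pow_self n (by norm_num))
  rw [← pow_mul] at h3
  have h4 := Nat.pow_right_injective (le_refl 2 |>.trans (by norm_num)) h3
  have hs := cpx_pos hn
  exact ⟨s - 1, by congr 1; omega, by omega⟩

/-! ### Values of low-defect polynomials and coverings of bounded-defect numbers. -/

theorem evalPowThree_C (m : ℕ) {d : ℕ} (n : Fin d → ℕ) :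
    evalPowThree (MvPolynomial.C m) n = m := by
  simp [evalPowThree]

theorem evalPowThree_tensor {d₁ d₂ : ℕ} (f₁ : MvPolynomial (Fin d₁) ℕ)
    (f₂ : MvPolynomial (Fin d₂) ℕ) (n : Fin (d₁ + d₂) → ℕ) :
    evalPowThree (MvPolynomial.rename (Fin.castAdd d₂) f₁ *
      MvPolynomial.rename (Fin.natAdd d₁) f₂) n =
      evalPowThree f₁ (fun i => n (Fin.castAdd d₂ i)) *
        evalPowThree f₂ (fun i => n (Fin.natAdd d₁ i)) := by
  simp only [evalPowThree, map_mul, MvPolynomial.eval_rename]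
  rfl

theorem evalPowThree_tensorX {d : ℕ} (f : MvPolynomial (Fin d) ℕ) (c : ℕ)
    (n : Fin (d + 1) → ℕ) :
    evalPowThree (MvPolynomial.rename Fin.castSucc f * MvPolynomial.X (Fin.last d) +
      MvPolynomial.C c) n =
      evalPowThree f (fun i => n i.castSucc) * 3 ^ n (Fin.last d) + c := by
  simp only [evalPowThree, map_mul, map_add, MvPolynomial.eval_rename, MvPolynomial.eval_X,
    MvPolynomial.eval_C]
  rfl

theorem LowDefectPair.evalPowThree_pos {d : ℕ} {f : MvPolynomial (Fin d) ℕ} {C : ℕ}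
    (h : LowDefectPair d f C) (n : Fin d → ℕ) : 0 < evalPowThree f n := by
  induction h with
  | const m C hm hC => rwa [evalPowThree_C]
  | tensor d₁ d₂ f₁ f₂ C₁ C₂ h₁ h₂ ih₁ ih₂ =>
    rw [evalPowThree_tensor]
    exact Nat.mul_pos (ih₁ _) (ih₂ _)
  | tensorX d f C c D h hc hD ih =>
    rw [evalPowThree_tensorX]
    omega

/-- `n` is represented by `(f, C)`, with a most efficient expression of `n` coming from `f`. -/
def EfficientlyRepresents (d : ℕ) (f : MvPolynomial (Fin d) ℕ) (C n : ℕ) : Prop :=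
  ∃ (m : Fin d → ℕ) (t : ℕ), n = 3 ^ t * evalPowThree f m ∧ cpx n = C + 3 * ∑ i, m i + 3 * t

/-- Finitely many low-defect pairs efficiently represent all elements of `A`. -/
def FinitelyCovered (A : Set ℕ) : Prop :=
  ∃ G : Set (Σ d, MvPolynomial (Fin d) ℕ × ℕ), G.Finite ∧
    (∀ p ∈ G, LowDefectPair p.1 p.2.1 p.2.2) ∧
    ∀ n ∈ A, ∃ p ∈ G, EfficientlyRepresents p.1 p.2.1 p.2.2 n

namespace FinitelyCovered

theorem mono {A B : Set ℕ} (hB : FinitelyCovered B) (h : A ⊆ B) : FinitelyCovered A := by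
  obtain ⟨G, h1, h2, h3⟩ := hB
  exact ⟨G, h1, h2, fun n hn => h3 n (h hn)⟩

theorem biUnion {ι : Type*} {s : Set ι} (hs : s.Finite) {A : ι → Set ℕ}
    (h : ∀ i ∈ s, FinitelyCovered (A i)) : FinitelyCovered (⋃ i ∈ s, A i) := by
  choose! G h1 h2 h3 using h
  refine ⟨⋃ i ∈ s, G i, hs.biUnion h1, fun p hp => ?_, fun n hn => ?_⟩
  · obtain ⟨i, hi, hp⟩ := Set.mem_iUnion₂.1 hp
    exact h2 i hi p hp
  · obtain ⟨i, hi, hn⟩ := Set.mem_iUnion₂.1 hn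
    obtain ⟨p, hp, hpn⟩ := h3 i hi n hn
    exact ⟨p, Set.mem_biUnion hi hp, hpn⟩

theorem union {A B : Set ℕ} (hA : FinitelyCovered A) (hB : FinitelyCovered B) :
    FinitelyCovered (A ∪ B) := by
  obtain ⟨G, h1, h2, h3⟩ := hA
  obtain ⟨G', h1', h2', h3'⟩ := hB
  refine ⟨G ∪ G', h1.union h1', fun p hp => hp.elim (h2 p) (h2' p), fun n hn => ?_⟩
  rcases hn with hn | hn
  · obtain ⟨p, hp, h⟩ := h3 n hn
    exact ⟨p, Or.inl hp, h⟩
  · obtain ⟨p, hp, h⟩ := h3' n hn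
    exact ⟨p, Or.inr hp, h⟩

theorem singleton {n : ℕ} (hn : 0 < n) : FinitelyCovered {n} := by
  refine ⟨{⟨0, MvPolynomial.C n, cpx n⟩}, Set.finite_singleton _, ?_, ?_⟩
  · rintro _ rfl
    exact .const n _ hn le_rfl
  · rintro _ rfl
    exact ⟨_, rfl, Fin.elim0, 0, by simp only [evalPowThree_C, pow_zero, one_mul], by simp⟩

theorem of_finite {A : Set ℕ} (hA : A.Finite) (h0 : ∀ n ∈ A, 0 < n) : FinitelyCovered A :=
  (biUnion hA fun n hn => singleton (h0 n hn)).mono fun n hn => by simpa using hn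

theorem mul {A B : Set ℕ} (hA : FinitelyCovered A) (hB : FinitelyCovered B) :
    FinitelyCovered {n | ∃ u ∈ A, ∃ v ∈ B, n = u * v ∧ cpx n = cpx u + cpx v} := by
  obtain ⟨G, h1, h2, h3⟩ := hA
  obtain ⟨G', h1', h2', h3'⟩ := hB
  let T : (Σ d, MvPolynomial (Fin d) ℕ × ℕ) → (Σ d, MvPolynomial (Fin d) ℕ × ℕ) →
      (Σ d, MvPolynomial (Fin d) ℕ × ℕ) := fun p q =>
    ⟨p.1 + q.1, MvPolynomial.rename (Fin.castAdd q.1) p.2.1 *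
      MvPolynomial.rename (Fin.natAdd p.1) q.2.1, p.2.2 + q.2.2⟩
  refine ⟨Set.image2 T G G', h1.image2 _ h1', ?_, ?_⟩
  · rintro _ ⟨p, hp, q, hq, rfl⟩
    exact .tensor _ _ _ _ _ _ (h2 p hp) (h2' q hq)
  · rintro n ⟨u, hu, v, hv, rfl, hc⟩
    obtain ⟨p, hp, m, t, rfl, hm⟩ := h3 u hu
    obtain ⟨q, hq, m', t', rfl, hm'⟩ := h3' v hv
    refine ⟨T p q, ⟨p, hp, q, hq, rfl⟩, Fin.append m m', t + t', ?_, ?_⟩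
    · simp only [T, evalPowThree_tensor, Fin.append_left, Fin.append_right]
      ring
    · rw [hc, hm, hm']
      simp only [T, Fin.sum_univ_add, Fin.append_left, Fin.append_right]
      ring

/-- The spare factor `3 ^ t` of `a` becomes the value of the new variable, at the same cost `3t`. -/
theorem add {A : Set ℕ} (hA : FinitelyCovered A) {b : ℕ} (hb : 0 < b) :
    FinitelyCovered {n | ∃ a ∈ A, n = a + b ∧ cpx n = cpx a + cpx b} := by
  obtain ⟨G, h1, h2, h3⟩ := hA
  let T : (Σ d, MvPolynomial (Fin d) ℕ × ℕ) → (Σ d, MvPolynomial (Fin d) ℕ × ℕ) := fun p =>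
    ⟨p.1 + 1, MvPolynomial.rename Fin.castSucc p.2.1 * MvPolynomial.X (Fin.last p.1) +
      MvPolynomial.C b, p.2.2 + cpx b⟩
  refine ⟨T '' G, h1.image _, ?_, ?_⟩
  · rintro _ ⟨p, hp, rfl⟩
    exact .tensorX _ _ _ _ _ (h2 p hp) hb le_rfl
  · rintro n ⟨a, ha, rfl, hc⟩
    obtain ⟨p, hp, m, t, rfl, hm⟩ := h3 a ha
    refine ⟨T p, ⟨p, hp, rfl⟩, Fin.snoc (α := fun _ => ℕ) m t, 0, ?_, ?_⟩
    · simp only [T, evalPowThree_tensorX, Fin.snoc_castSucc, Fin.snoc_last]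
      ring
    · rw [hc, hm]
      simp only [T, Fin.sum_univ_castSucc, Fin.snoc_castSucc, Fin.snoc_last]
      ring

end FinitelyCovered

/-- The positive integers of defect less than `r`. -/
def defectBelow (r : ℝ) : Set ℕ := {n | 0 < n ∧ defect n < r}

/-- `n = a + b` is the last step of a most efficient expression of `n`. -/
def IsEfficientSum (n a b : ℕ) : Prop := 0 < b ∧ b ≤ a ∧ n = a + b ∧ cpx n = cpx a + cpx b

theorem three_mul_logb_le_half {x : ℝ} (hx : 0 < x) (h : x ^ 6 ≤ 3) : 3 * Real.logb 3 x ≤ 1 / 2 := by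
  have h1 := Real.logb_le_logb_of_le (b := 3) (by norm_num) (by positivity) h
  rw [Real.logb_pow, Real.logb_self_eq_one (by norm_num)] at h1
  push_cast at h1; linarith

theorem IsEfficientSum.defect_left_eq {n a b : ℕ} (h : IsEfficientSum n a b) :
    defect a = defect n - cpx b + 3 * Real.logb 3 (1 + b / a) := by
  obtain ⟨hb, hba, rfl, hc⟩ := h
  have ha : (0 : ℝ) < a := by exact_mod_cast hb.trans_le hba
  have e : ((a + b : ℕ) : ℝ) = a * (1 + b / a) := by push_cast; field_simp
  have : logThree (a + b) = logThree a + 3 * Real.logb 3 (1 + b / a) := by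
    rw [logThree, logThree, e, Real.logb_mul ha.ne' (by positivity)]; ring
  rw [defect_eq, defect_eq, hc, this]
  push_cast; ring

theorem IsEfficientSum.logb_le {n a b : ℕ} (h : IsEfficientSum n a b) :
    3 * Real.logb 3 (1 + b / a) ≤ 2 := by
  obtain ⟨hb, hba, rfl, hc⟩ := h
  have ha : (0 : ℝ) < a := by exact_mod_cast hb.trans_le hba
  have h1 : (1 : ℝ) + b / a ≤ 2 := by
    have : (b : ℝ) / a ≤ 1 := (div_le_one ha).2 (by exact_mod_cast hba)
    linarith
  have h2 := Real.logb_le_logb_of_le (b := 3) (by norm_num) (by positivity)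
    (pow_le_pow_left₀ (by positivity) h1 3)
  have h3 := Real.logb_le_logb_of_le (b := 3) (by norm_num) (by norm_num)
    (by norm_num : (2 : ℝ) ^ 3 ≤ 3 ^ 2)
  rw [Real.logb_pow] at h2
  have h4 : Real.logb 3 (3 ^ 2) = 2 := by
    rw [Real.logb_pow, Real.logb_self_eq_one (by norm_num)]; norm_num
  push_cast at h2
  exact h2.trans (h3.trans h4.le)

/-- The change of defect is `-‖b‖ + 3 log₃(1 + b/a)`, and the logarithmic term is at most `2`; so
`‖b‖ ≥ 3` suffices. If `‖b‖` is `1` or `2`, then `b ≤ ‖b‖` and `a ≥ 6`, and `(7/6)⁶ ≤ 3`,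
respectively `(4/3)³ ≤ 3`, bounds the term by `1/2`, respectively `1`. -/
theorem IsEfficientSum.defect_left_le {n a b : ℕ} (h : IsEfficientSum n a b) (hn : 8 ≤ n) :
    defect a ≤ defect n - 1 / 2 := by
  have e := h.defect_left_eq
  have hl := h.logb_le
  obtain ⟨hb, hba, rfl, hc⟩ := h
  have ha : (0 : ℝ) < a := by exact_mod_cast hb.trans_le hba
  have hp := pow_three_le_three_pow_cpx hb
  have hb1 := cpx_pos hb
  rcases (by omega : cpx b = 1 ∨ cpx b = 2 ∨ 3 ≤ cpx b) with h | h | h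
  · rw [h] at hp
    have : b = 1 := by
      by_contra hne
      have : 2 ^ 3 ≤ b ^ 3 := Nat.pow_le_pow_left (by omega) 3
      omega
    subst this
    have h6 : (6 : ℝ) ≤ a := by exact_mod_cast (by omega : 6 ≤ a)
    have h7 : (1 : ℝ) + (1 : ℕ) / a ≤ 7 / 6 := by
      have : ((1 : ℕ) : ℝ) / a ≤ 1 / 6 := by
        rw [Nat.cast_one]; exact one_div_le_one_div_of_le (by norm_num) h6
      linarith
    have := three_mul_logb_le_half (x := 1 + (1 : ℕ) / a) (by positivity)
      ((pow_le_pow_left₀ (by positivity) h7 6).trans (by norm_num))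
    rw [e, h]; push_cast at *; linarith
  · rw [h] at hp
    have hb2 : b ≤ 2 := by
      by_contra! hlt
      have : 3 ^ 3 ≤ b ^ 3 := Nat.pow_le_pow_left (by omega) 3
      omega
    have h6 : (6 : ℝ) ≤ a := by exact_mod_cast (by omega : 6 ≤ a)
    have hb2' : (b : ℝ) ≤ 2 := by exact_mod_cast hb2
    have h7 : (1 : ℝ) + b / a ≤ 4 / 3 := by
      have : (b : ℝ) / a ≤ 1 / 3 := by
        rw [div_le_div_iff₀ ha (by norm_num)]; linarith
      linarith
    have h8 := Real.logb_le_logb_of_le (b := 3) (by norm_num) (by positivity)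
      ((pow_le_pow_left₀ (by positivity) h7 3).trans (by norm_num : (4 / 3 : ℝ) ^ 3 ≤ 3))
    rw [Real.logb_pow, Real.logb_self_eq_one (by norm_num)] at h8
    rw [e, h]; push_cast at *; linarith
  · have : (3 : ℝ) ≤ cpx b := by exact_mod_cast h
    rw [e]; linarith

theorem finite_cpx_le (K : ℕ) : {b | 0 < b ∧ cpx b ≤ K}.Finite := by
  refine (Set.finite_Iic (3 ^ K)).subset ?_
  rintro b ⟨hb, hK⟩
  have h := pow_three_le_three_pow_cpx hb
  calc b ≤ b ^ 3 := Nat.le_self_pow (by norm_num) b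
    _ ≤ 3 ^ cpx b := h
    _ ≤ 3 ^ K := Nat.pow_le_pow_right (by norm_num) hK

/-- `n` is `1` or a most efficient sum. -/
def IsEndSum (n : ℕ) : Prop := n = 1 ∨ ∃ a b, IsEfficientSum n a b

/-- The larger summand `a` falls below defect `r`, while `‖b‖ ≤ δ(n) + 2 < r + s + 2` leaves
finitely many `b`. Numbers below `8` are covered one by one. -/
theorem finitelyCovered_isEndSum {r s : ℝ} (hs : s ≤ 1 / 2)
    (hr : FinitelyCovered (defectBelow r)) :
    FinitelyCovered {n | n ∈ defectBelow (r + s) ∧ IsEndSum n} := by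
  obtain ⟨K, hK⟩ := exists_nat_ge (r + s + 2)
  have h1 : FinitelyCovered {n | 0 < n ∧ n < 8} :=
    .of_finite ((Set.finite_Iio 8).subset fun n hn => hn.2) fun n hn => hn.1
  have h2 := FinitelyCovered.biUnion (finite_cpx_le K) fun b hb => hr.add hb.1
  refine (h1.union h2).mono ?_
  rintro n ⟨⟨hn0, hn⟩, rfl | ⟨a, b, h⟩⟩
  · exact Or.inl (by simp)
  by_cases hn8 : n < 8
  · exact Or.inl ⟨hn0, hn8⟩
  right
  have hle := h.defect_left_le (not_lt.1 hn8)
  have heq := h.defect_left_eq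
  have hl := h.logb_le
  obtain ⟨hb, hba, hab, hc⟩ := h
  have ha0 := defect_nonneg (hb.trans_le hba)
  refine Set.mem_biUnion (x := b) ⟨hb, ?_⟩ ⟨a, ⟨hb.trans_le hba, by linarith⟩, hab, hc⟩
  have : (cpx b : ℝ) ≤ K := by linarith
  exact_mod_cast this

/-- A positive gap above `0` in the set of all defects. -/
theorem exists_defect_gap : ∃ s : ℝ, 0 < s ∧ s ≤ 1 / 2 ∧
    ∀ n, 0 < n → defect n < s → defect n = 0 := by
  obtain ⟨s, hs0, hs, hs8⟩ : ∃ s : ℝ, 0 < s ∧ s ≤ 1 / 2 ∧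
      ∀ n < 8, 0 < defect n → s ≤ defect n := by
    have : ∀ N : ℕ, ∃ s : ℝ, 0 < s ∧ s ≤ 1 / 2 ∧ ∀ n < N, 0 < defect n → s ≤ defect n := by
      intro N
      induction N with
      | zero => exact ⟨1 / 2, by norm_num, le_rfl, by simp⟩
      | succ N ih =>
        obtain ⟨s, hs0, hs, h⟩ := ih
        by_cases hN : 0 < defect N
        · refine ⟨min s (defect N), lt_min hs0 hN, (min_le_left _ _).trans hs, fun n hn hn0 => ?_⟩
          rcases Nat.lt_succ_iff_lt_or_eq.1 hn with hn | rfl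
          · exact (min_le_left _ _).trans (h n hn hn0)
          · exact min_le_right _ _
        · refine ⟨s, hs0, hs, fun n hn hn0 => ?_⟩
          rcases Nat.lt_succ_iff_lt_or_eq.1 hn with hn | rfl
          · exact h n hn hn0
          · exact absurd hn0 hN
    exact this 8
  refine ⟨s, hs0, hs, fun n => ?_⟩
  induction n using Nat.strong_induction_on with
  | _ n ih =>
    intro hn0 hn
    have hnn := defect_nonneg hn0
    by_cases hn8 : n < 8
    · by_contra hne
      exact absurd (hs8 n hn8 (lt_of_le_of_ne hnn (Ne.symm hne))) (not_le.2 hn)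
    -- A sum `n ≥ 8` has defect at least `1/2 ≥ s`; a product has factors of smaller defect, to
    -- which induction applies.
    rcases cpx_cases hn0 with rfl | ⟨a, b, h⟩ | ⟨u, v, hu, hv, hun, hvn, rfl, hc⟩
    · omega
    · have := IsEfficientSum.defect_left_le h (not_lt.1 hn8)
      have := defect_nonneg (h.1.trans_le h.2.1)
      linarith
    · have e := defect_mul hu hv hc
      have hu' := defect_nonneg hu
      have hv' := defect_nonneg hv
      rw [e, ih u hun hu (by linarith), ih v hvn hv (by linarith), add_zero]

/-- As long as one factor has defect at least `r`, the descent continues into it. Its cofactors have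
total defect below `s` and are collected in `v`; the descent stops at `1`, at a sum, or at a product
of two numbers of defect below `r`. -/
theorem exists_product_form {r s : ℝ} (n : ℕ) (hn0 : 0 < n) (hn : defect n < r + s)
    (hr : r ≤ defect n) :
    ∃ x v, 0 < x ∧ r ≤ defect x ∧ (IsEndSum x ∨ ∃ p ∈ defectBelow r, ∃ q ∈ defectBelow r,
      x = p * q ∧ cpx x = cpx p + cpx q) ∧
      (n = x ∨ (v ∈ defectBelow s ∧ n = x * v ∧ cpx n = cpx x + cpx v)) := by
  induction n using Nat.strong_induction_on with
  | _ n ih =>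
    have key : ∀ u v, 0 < u → 0 < v → u < n → n = u * v → cpx n = cpx u + cpx v → r ≤ defect u →
        ∃ x v, 0 < x ∧ r ≤ defect x ∧ (IsEndSum x ∨ ∃ p ∈ defectBelow r, ∃ q ∈ defectBelow r,
          x = p * q ∧ cpx x = cpx p + cpx q) ∧
          (n = x ∨ (v ∈ defectBelow s ∧ n = x * v ∧ cpx n = cpx x + cpx v)) := by
      intro u v hu hv hun huv hc hru
      have e : defect n = defect u + defect v := by
        subst huv; exact defect_mul hu hv hc
      have hv0 := defect_nonneg hv
      obtain ⟨x, w, hx, hrx, hX, rfl | ⟨hw, huw, hcu⟩⟩ := ih u hun hu (by linarith) hru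
      · exact ⟨u, v, hx, hrx, hX, Or.inr ⟨⟨hv, by linarith⟩, huv, hc⟩⟩
      · have h1 : n = x * (w * v) := by rw [huv, huw, mul_assoc]
        have hwv : 0 < w * v := Nat.mul_pos hw.1 hv
        have h2 := cpx_mul_le hw.1 hv
        have h3 := cpx_mul_le hx hwv
        rw [← h1] at h3
        -- Regrouping stays efficient: subadditivity over products bounds both sides by each other.
        have h4 : cpx n = cpx x + cpx (w * v) := by omega
        have e' : defect n = defect x + defect (w * v) := by
          rw [h1] at h4 ⊢; exact defect_mul hx hwv h4
        exact ⟨x, w * v, hx, hrx, hX, Or.inr ⟨⟨hwv, by linarith⟩, h1, h4⟩⟩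
    rcases cpx_cases hn0 with h | ⟨a, b, h⟩ | ⟨u, v, hu, hv, hun, hvn, huv, hc⟩
    · exact ⟨n, 1, hn0, hr, Or.inl (Or.inl h), Or.inl rfl⟩
    · exact ⟨n, 1, hn0, hr, Or.inl (Or.inr ⟨a, b, h⟩), Or.inl rfl⟩
    · rcases le_or_gt r (defect u) with h1 | h1
      · exact key u v hu hv hun huv hc h1
      rcases le_or_gt r (defect v) with h2 | h2
      · exact key v u hv hu hvn (by rw [huv, mul_comm]) (by omega) h2
      exact ⟨n, 1, hn0, hr, Or.inr ⟨u, ⟨hu, h1⟩, v, ⟨hv, h2⟩, huv, hc⟩, Or.inl rfl⟩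

theorem finitelyCovered_step {r s : ℝ} (hs : s ≤ 1 / 2) (hsr : s ≤ r)
    (hr : FinitelyCovered (defectBelow r)) : FinitelyCovered (defectBelow (r + s)) := by
  have hX := (finitelyCovered_isEndSum hs hr).union (hr.mul hr)
  refine (hr.union (hX.union (hX.mul hr))).mono ?_
  rintro n ⟨hn0, hn⟩
  rcases lt_or_ge (defect n) r with h | h
  · exact Or.inl ⟨hn0, h⟩
  obtain ⟨x, v, hx, hrx, hX, hxv⟩ := exists_product_form n hn0 hn h
  have hx' : defect x < r + s := by
    rcases hxv with rfl | ⟨hv, rfl, hc⟩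
    · exact hn
    · have := defect_nonneg hv.1
      rw [defect_mul hx hv.1 hc] at hn
      linarith
  have hX' : x ∈ {n | n ∈ defectBelow (r + s) ∧ IsEndSum n} ∪ {n | ∃ u ∈ defectBelow r,
      ∃ v ∈ defectBelow r, n = u * v ∧ cpx n = cpx u + cpx v} :=
    hX.imp (fun h => ⟨⟨hx, hx'⟩, h⟩) id
  right
  rcases hxv with rfl | ⟨hv, hxv, hc⟩
  · exact Or.inl hX'
  · exact Or.inr ⟨x, hX', v, ⟨hv.1, hv.2.trans_le hsr⟩, hxv, hc⟩

/-- Numbers of bounded defect are efficiently represented by finitely many low-defect pairs. -/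
theorem finitelyCovered_defectBelow (r : ℝ) : FinitelyCovered (defectBelow r) := by
  obtain ⟨s, hs0, hs, hgap⟩ := exists_defect_gap
  -- Below the gap all defects vanish, so only the numbers `3 ^ t * 3` remain; the number `1` has
  -- defect `1`.
  have base : FinitelyCovered (defectBelow s) := by
    refine ⟨{⟨0, MvPolynomial.C 3, 3⟩}, Set.finite_singleton _, ?_, ?_⟩
    · rintro _ rfl
      exact .const 3 _ (by norm_num) cpx_three_le
    · rintro n ⟨hn0, hn⟩
      obtain ⟨t, rfl, ht⟩ := eq_three_pow_of_defect_eq_zero hn0 (hgap n hn0 hn)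
      exact ⟨_, rfl, Fin.elim0, t, by simp only [evalPowThree_C, pow_succ], by simp [ht]; ring⟩
  have h : ∀ k : ℕ, FinitelyCovered (defectBelow ((k + 1) * s)) := by
    intro k
    induction k with
    | zero => simpa using base
    | succ k ih =>
      have := finitelyCovered_step hs (by nlinarith [Nat.cast_nonneg (α := ℝ) k]) ih
      convert this using 2
      push_cast; ring
  obtain ⟨k, hk⟩ := exists_nat_ge (r / s)
  refine (h k).mono fun n hn => ⟨hn.1, hn.2.trans_le ?_⟩
  rw [div_le_iff₀ hs0] at hk
  nlinarith

/-! ### Stable complexity and stable defect. -/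

theorem three_mul_le_cpx {n : ℕ} (hn : 0 < n) (k : ℕ) : 3 * k ≤ cpx (3 ^ k * n) := by
  have h := logThree_le_cpx (n := 3 ^ k * n) (by positivity)
  rw [logThree_mul (by positivity) hn, logThree_three_pow] at h
  have := logThree_nonneg hn
  have : (3 : ℝ) * k ≤ cpx (3 ^ k * n) := by linarith
  exact_mod_cast this

/-- `‖3^k n‖ - 3k` never increases with `k`, so `3^k n` is stable once the minimum is reached. By
`three_mul_le_cpx` the truncated subtraction is exact. -/
theorem exists_isStable {n : ℕ} (hn : 0 < n) : ∃ k, IsStable (3 ^ k * n) := by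
  obtain ⟨k, hk⟩ : ∃ k, ∀ j, cpx (3 ^ k * n) - 3 * k ≤ cpx (3 ^ j * n) - 3 * j := by
    obtain ⟨_, ⟨k, rfl⟩, hk⟩ := WellFounded.has_min (wellFounded_lt (α := ℕ))
      (Set.range fun k => cpx (3 ^ k * n) - 3 * k) (Set.range_nonempty _)
    exact ⟨k, fun j => not_lt.1 (hk _ ⟨j, rfl⟩)⟩
  refine ⟨k, fun j => ?_⟩
  have h1 := cpx_three_pow_mul_le j (n := 3 ^ k * n) (by positivity)
  have h2 := hk (j + k)
  have h3 := three_mul_le_cpx hn k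
  have h4 := three_mul_le_cpx hn (j + k)
  rw [pow_add, mul_assoc] at h2 h4
  omega

theorem IsStable.three_pow_mul {n : ℕ} (h : IsStable n) (k : ℕ) : IsStable (3 ^ k * n) := by
  intro j
  rw [← mul_assoc, ← pow_add, h, h]
  ring

theorem isStable_stabIndex {n : ℕ} (hn : 0 < n) : IsStable (3 ^ stabIndex n * n) :=
  Nat.sInf_mem (s := {k | IsStable (3 ^ k * n)}) (exists_isStable hn)

theorem cpxSt_le {n : ℕ} (hn : 0 < n) (k : ℕ) : cpxSt n ≤ cpx (3 ^ k * n) - 3 * k := by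
  have h1 := isStable_stabIndex hn k
  have h2 := cpx_three_pow_mul_le (stabIndex n) (n := 3 ^ k * n) (by positivity)
  rw [← mul_assoc, mul_comm (3 ^ _) (3 ^ _), mul_assoc, h1] at h2
  rw [cpxSt]
  omega

theorem cpxSt_le_cpx {n : ℕ} (hn : 0 < n) : cpxSt n ≤ cpx n := by
  simpa using cpxSt_le hn 0

theorem cpxSt_eq_of_isStable {n k : ℕ} (hn : 0 < n) (h : IsStable (3 ^ k * n)) :
    cpxSt n = cpx (3 ^ k * n) - 3 * k := by
  refine le_antisymm (cpxSt_le hn k) ?_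
  have h1 := h (stabIndex n)
  have h2 := cpx_three_pow_mul_le k (n := 3 ^ stabIndex n * n) (by positivity)
  rw [← mul_assoc, mul_comm (3 ^ _) (3 ^ _), mul_assoc, h1] at h2
  rw [cpxSt]
  omega

theorem cpxSt_three_pow_mul {n : ℕ} (hn : 0 < n) (k : ℕ) :
    cpxSt (3 ^ k * n) = cpxSt n + 3 * k := by
  have h := isStable_stabIndex hn
  have e : 3 ^ stabIndex n * (3 ^ k * n) = 3 ^ k * (3 ^ stabIndex n * n) := by ring
  rw [cpxSt_eq_of_isStable (k := stabIndex n) (by positivity) (by rw [e]; exact h.three_pow_mul k),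
    cpxSt_eq_of_isStable hn h, e, h k]
  push_cast; ring

theorem defectSt_eq {n : ℕ} (hn : 0 < n) : defectSt n = cpxSt n - logThree n := by
  rw [defectSt, defect_eq, logThree_mul (by positivity) hn, logThree_three_pow, cpxSt]
  push_cast; ring

theorem defectSt_nonneg {n : ℕ} (hn : 0 < n) : 0 ≤ defectSt n :=
  defect_nonneg (by positivity)

theorem defectSt_three_pow_mul {n : ℕ} (hn : 0 < n) (k : ℕ) :
    defectSt (3 ^ k * n) = defectSt n := by
  rw [defectSt_eq (by positivity), defectSt_eq hn, logThree_mul (by positivity) hn,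
    logThree_three_pow, cpxSt_three_pow_mul hn]
  push_cast; ring

/-- The stable defect depends only on the class of `n` modulo powers of `3`. -/
theorem defectSt_eq_of_logThree_sub {a b : ℕ} (ha : 0 < a) (hb : 0 < b) (z : ℤ)
    (h : logThree a - logThree b = z) : defectSt a = defectSt b := by
  wlog hz : 0 ≤ z generalizing a b z
  · exact (this hb ha (-z) (by push_cast; linarith) (by omega)).symm
  lift z to ℕ using hz
  -- The hypothesis makes `a / b` only a cube root of `3 ^ z`; since `a / b` is rational, it is
  -- itself a power of `3`.
  have h3 : a ^ 3 = 3 ^ z * b ^ 3 := by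
    apply logThree_inj (by positivity) (by positivity)
    rw [logThree_pow, logThree_mul (by positivity) (by positivity),
      logThree_three_pow, logThree_pow]
    push_cast at h ⊢; linarith
  have hd : b ∣ a := (Nat.pow_dvd_pow_iff (by norm_num : (3 : ℕ) ≠ 0)).1 ⟨3 ^ z, by rw [h3, mul_comm]⟩
  obtain ⟨q, rfl⟩ := hd
  have hq : q ^ 3 = 3 ^ z := by
    have : b ^ 3 * q ^ 3 = b ^ 3 * 3 ^ z := by rw [← mul_pow, h3, mul_comm]
    exact Nat.eq_of_mul_eq_mul_left (by positivity) this
  obtain ⟨s, -, rfl⟩ := (Nat.dvd_prime_pow Nat.prime_three).1 (hq ▸ dvd_pow_self q (by norm_num))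
  rw [mul_comm, defectSt_three_pow_mul hb]

/-! ### Leading coefficients and the growth of low-defect polynomials. -/

/-- Bounds of the form `F ≤ (b + K/T) S` multiply; the term `K₁K₂/T²` is absorbed into `K₁K₂/T`. -/
theorem mul_mul_three_pow_le {F₁ F₂ b₁ b₂ K₁ K₂ S₁ S₂ T : ℕ} (hT : 0 < T)
    (h₁ : F₁ * T ≤ (b₁ * T + K₁) * S₁) (h₂ : F₂ * T ≤ (b₂ * T + K₂) * S₂) :
    F₁ * F₂ * T ≤ (b₁ * b₂ * T + (b₁ * K₂ + b₂ * K₁ + K₁ * K₂)) * (S₁ * S₂) := by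
  refine Nat.le_of_mul_le_mul_right (c := T) ?_ hT
  calc F₁ * F₂ * T * T = (F₁ * T) * (F₂ * T) := by ring
    _ ≤ ((b₁ * T + K₁) * S₁) * ((b₂ * T + K₂) * S₂) := Nat.mul_le_mul h₁ h₂
    _ = (b₁ * b₂ * T * T + (b₁ * K₂ + b₂ * K₁) * T + K₁ * K₂ * 1) * (S₁ * S₂) := by ring
    _ ≤ (b₁ * b₂ * T * T + (b₁ * K₂ + b₂ * K₁) * T + K₁ * K₂ * T) * (S₁ * S₂) := by
      gcongr; exact hT
    _ = _ := by ring

/-- A free variable enters through `f·x + e`, where `e` costs at least one `1` and does not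
contribute to `b`; this saving accounts for the count of `J` in the complexity bound. -/
theorem LowDefectPair.exists_lead_aux {d : ℕ} {f : MvPolynomial (Fin d) ℕ} {C : ℕ}
    (h : LowDefectPair d f C) (J : Fin d → Bool) (c : Fin d → ℕ) :
    ∃ b K, 0 < b ∧
      cpx b + (∑ i, if J i then 1 else 0) ≤ C + 3 * (∑ i, if J i then 0 else c i) ∧
      ∀ n : Fin d → ℕ, (∀ i, J i = false → n i = c i) →
        b * 3 ^ (∑ i, if J i then n i else 0) ≤ evalPowThree f n ∧
        ∀ M, (∀ i, J i = true → M ≤ n i) →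
          evalPowThree f n * 3 ^ M ≤ (b * 3 ^ M + K) * 3 ^ (∑ i, if J i then n i else 0) := by
  induction h with
  | const m C hm hC =>
    exact ⟨m, 0, hm, by simpa using hC, fun n _ => by rw [evalPowThree_C]; simp⟩
  | tensor d₁ d₂ f₁ f₂ C₁ C₂ h₁ h₂ ih₁ ih₂ =>
    obtain ⟨b₁, K₁, hb₁, hc₁, H₁⟩ :=
      ih₁ (fun i => J (Fin.castAdd d₂ i)) (fun i => c (Fin.castAdd d₂ i))
    obtain ⟨b₂, K₂, hb₂, hc₂, H₂⟩ :=
      ih₂ (fun i => J (Fin.natAdd d₁ i)) (fun i => c (Fin.natAdd d₁ i))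
    refine ⟨b₁ * b₂, b₁ * K₂ + b₂ * K₁ + K₁ * K₂, Nat.mul_pos hb₁ hb₂, ?_, fun n hn => ?_⟩
    · have := cpx_mul_le hb₁ hb₂
      simp only [Fin.sum_univ_add]
      omega
    · obtain ⟨l₁, u₁⟩ := H₁ (fun i => n (Fin.castAdd d₂ i)) fun i hi => hn _ hi
      obtain ⟨l₂, u₂⟩ := H₂ (fun i => n (Fin.natAdd d₁ i)) fun i hi => hn _ hi
      simp only [Fin.sum_univ_add, evalPowThree_tensor, pow_add]
      refine ⟨?_, fun M hM => ?_⟩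
      · calc _ = _ := by rw [mul_mul_mul_comm]
          _ ≤ _ := Nat.mul_le_mul l₁ l₂
      · exact mul_mul_three_pow_le (by positivity) (u₁ M fun i hi => hM _ hi)
          (u₂ M fun i hi => hM _ hi)
  | tensorX d f C e D h he hD ih =>
    obtain ⟨b, K, hb, hc, H⟩ := ih (fun i => J i.castSucc) (fun i => c i.castSucc)
    have he1 := cpx_pos he
    simp only [Fin.sum_univ_castSucc, evalPowThree_tensorX, pow_add]
    rcases hJ : J (Fin.last d) with _ | _
    · have hb' := cpx_three_pow_mul_le (c (Fin.last d)) hb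
      -- With the last variable fixed, `e` is negligible if an earlier variable is free and goes
      -- into `K`; otherwise `f` is a constant and `e` must be part of `b`.
      by_cases hall : ∃ i : Fin d, J i.castSucc = true
      · refine ⟨3 ^ c (Fin.last d) * b, 3 ^ c (Fin.last d) * K + e, by positivity, ?_,
          fun n hn => ?_⟩
        · simp only [Bool.false_eq_true, if_false]
          omega
        · obtain ⟨l, u⟩ := H (fun i => n i.castSucc) fun i hi => hn _ hi
          simp only [Bool.false_eq_true, if_false, pow_zero, mul_one, hn _ hJ]
          refine ⟨?_, fun M hM => ?_⟩
          · calc _ = b * 3 ^ (∑ i : Fin d, if J i.castSucc = true then n i.castSucc else 0) *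
                3 ^ c (Fin.last d) := by ring
              _ ≤ _ := (Nat.mul_le_mul_right _ l).trans (Nat.le_add_right _ _)
          · have hM' : 3 ^ M ≤ 3 ^ (∑ i : Fin d, if J i.castSucc = true then n i.castSucc else 0) := by
              obtain ⟨i, hi⟩ := hall
              refine Nat.pow_le_pow_right (by norm_num) ((hM _ hi).trans ?_)
              have := Finset.single_le_sum
                (f := fun i : Fin d => if J i.castSucc = true then n i.castSucc else 0)
                (fun _ _ => Nat.zero_le _) (Finset.mem_univ i)
              simpa [hi] using this
            have u' := u M fun i hi => hM _ hi
            calc _ = evalPowThree f (fun i => n i.castSucc) * 3 ^ M * 3 ^ c (Fin.last d) +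
                  e * 3 ^ M := by ring
              _ ≤ _ := Nat.add_le_add (Nat.mul_le_mul_right _ u') (Nat.mul_le_mul_left e hM')
              _ = _ := by ring
      · have hall' : ∀ i : Fin d, J i.castSucc = false := by simpa using hall
        have hadd := cpx_add_le (a := 3 ^ c (Fin.last d) * b) (by positivity) he
        simp only [hall', Bool.false_eq_true, if_false, Finset.sum_const_zero, pow_zero,
          mul_one] at hc H ⊢
        refine ⟨3 ^ c (Fin.last d) * b + e, 3 ^ c (Fin.last d) * K, by positivity, ?_,
          fun n hn => ?_⟩
        · omega
        · obtain ⟨l, u⟩ := H (fun i => n i.castSucc) fun i _ => hn _ (hall' i)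
          rw [hn _ hJ]
          refine ⟨?_, fun M hM => ?_⟩
          · rw [mul_comm (3 ^ _)]
            exact Nat.add_le_add_right (Nat.mul_le_mul_right _ l) _
          · have u' := u M (by simp)
            calc _ = evalPowThree f (fun i => n i.castSucc) * 3 ^ M * 3 ^ c (Fin.last d) +
                  e * 3 ^ M := by ring
              _ ≤ _ := Nat.add_le_add_right (Nat.mul_le_mul_right _ u') _
              _ = _ := by ring
    · refine ⟨b, K + e, hb, ?_, fun n hn => ?_⟩
      · simp only [if_true]
        omega
      · obtain ⟨l, u⟩ := H (fun i => n i.castSucc) fun i hi => hn _ hi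
        simp only [if_true]
        refine ⟨?_, fun M hM => ?_⟩
        · rw [← mul_assoc]
          exact (Nat.mul_le_mul_right _ l).trans (Nat.le_add_right _ _)
        · have u' := u M fun i hi => hM _ hi
          have hM' : 3 ^ M ≤ 3 ^ (∑ i : Fin d, if J i.castSucc = true then n i.castSucc else 0) *
              3 ^ n (Fin.last d) :=
            (Nat.pow_le_pow_right (by norm_num) (hM _ hJ)).trans
              (Nat.le_mul_of_pos_left _ (by positivity))
          calc _ = evalPowThree f (fun i => n i.castSucc) * 3 ^ M * 3 ^ n (Fin.last d) +
                e * 3 ^ M := by ring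
            _ ≤ _ := Nat.add_le_add (Nat.mul_le_mul_right _ u') (Nat.mul_le_mul_left e hM')
            _ = _ := by ring

/-- `b` is the leading coefficient of `f` in the variables indexed by `J`, once the variables
outside `J` are set to the powers of `3` with exponents `c`: it governs the growth of `f`. -/
def IsLeadOn {d : ℕ} (f : MvPolynomial (Fin d) ℕ) (J : Finset (Fin d)) (c : Fin d → ℕ)
    (b : ℕ) : Prop :=
  ∃ K, ∀ n : Fin d → ℕ, (∀ i ∉ J, n i = c i) →
    b * 3 ^ (∑ i ∈ J, n i) ≤ evalPowThree f n ∧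
    ∀ M, (∀ i ∈ J, M ≤ n i) →
      evalPowThree f n * 3 ^ M ≤ (b * 3 ^ M + K) * 3 ^ (∑ i ∈ J, n i)

theorem LowDefectPair.exists_isLeadOn {d : ℕ} {f : MvPolynomial (Fin d) ℕ} {C : ℕ}
    (h : LowDefectPair d f C) (J : Finset (Fin d)) (c : Fin d → ℕ) :
    ∃ b, 0 < b ∧ cpx b + J.card ≤ C + 3 * ∑ i ∈ Jᶜ, c i ∧ IsLeadOn f J c b := by
  obtain ⟨b, K, hb, hc, H⟩ := h.exists_lead_aux (fun i => decide (i ∈ J)) c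
  have e1 : ∀ g : Fin d → ℕ, (∑ i, if i ∈ J then g i else 0) = ∑ i ∈ J, g i := fun g => by
    rw [Finset.sum_ite_mem, Finset.univ_inter]
  have e2 : (∑ i, if i ∈ J then 0 else c i) = ∑ i ∈ Jᶜ, c i := by
    rw [← Finset.sum_filter_add_sum_filter_not Finset.univ (· ∈ J)]
    rw [Finset.sum_congr rfl (g := fun _ => 0) (by simp +contextual),
      Finset.sum_const_zero, zero_add]
    refine Finset.sum_congr (by ext; simp) (by simp +contextual)
  simp only [decide_eq_true_eq, decide_eq_false_iff_not, e1, e2] at hc H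
  exact ⟨b, hb, by simpa using hc, K, H⟩

theorem IsLeadOn.le {d : ℕ} {f : MvPolynomial (Fin d) ℕ} {J : Finset (Fin d)} {c : Fin d → ℕ}
    {b b' : ℕ} (h : IsLeadOn f J c b) (h' : IsLeadOn f J c b') : b ≤ b' := by
  obtain ⟨_, h⟩ := h
  obtain ⟨K, h'⟩ := h'
  -- With all free exponents equal to `K`, the error term is `K < 3 ^ K`, too small to bridge an
  -- integer gap between `b` and `b'`.
  let n : Fin d → ℕ := fun i => if i ∈ J then K else c i
  have hn : ∀ i ∉ J, n i = c i := fun i hi => if_neg hi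
  have h1 := (h n hn).1
  have h2 := (h' n hn).2 K fun i hi => (if_pos hi).ge
  have h3 : b * 3 ^ K ≤ b' * 3 ^ K + K := by
    refine Nat.le_of_mul_le_mul_right (c := 3 ^ (∑ i ∈ J, n i)) ?_ (by positivity)
    calc _ = b * 3 ^ (∑ i ∈ J, n i) * 3 ^ K := by ring
      _ ≤ _ := (Nat.mul_le_mul_right _ h1).trans h2
  have h4 : K < 3 ^ K := Nat.lt_pow_self (by norm_num)
  by_contra! hlt
  have : (b' + 1) * 3 ^ K ≤ b * 3 ^ K := Nat.mul_le_mul_right _ hlt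
  nlinarith

/-- Every exponent in every monomial of `f` is at most `1`. -/
def IsMultilinear {σ : Type*} (f : MvPolynomial σ ℕ) : Prop :=
  ∀ s ∈ f.support, ∀ i, s i ≤ 1

theorem apply_of_mem_support_rename {σ τ : Type*} {g : σ → τ} (hg : Function.Injective g)
    {f : MvPolynomial σ ℕ} (hf : IsMultilinear f) {s : τ →₀ ℕ}
    (hs : s ∈ (MvPolynomial.rename g f).support) (i : τ) :
    s i ≤ 1 ∧ (i ∉ Set.range g → s i = 0) := by
  obtain ⟨u, rfl, hu⟩ := MvPolynomial.coeff_rename_ne_zero g f s (MvPolynomial.mem_support_iff.1 hs)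
  by_cases hi : i ∈ Set.range g
  · obtain ⟨j, rfl⟩ := hi
    rw [Finsupp.mapDomain_apply hg]
    exact ⟨hf u (MvPolynomial.mem_support_iff.2 hu) j, fun h => absurd ⟨j, rfl⟩ h⟩
  · rw [Finsupp.mapDomain_of_notMem_range _ _ hi]
    simp

theorem LowDefectPair.isMultilinear {d : ℕ} {f : MvPolynomial (Fin d) ℕ} {C : ℕ}
    (h : LowDefectPair d f C) : IsMultilinear f := by
  classical
  induction h with
  | const m C hm hC => exact fun s _ i => i.elim0
  | tensor d₁ d₂ f₁ f₂ C₁ C₂ h₁ h₂ ih₁ ih₂ =>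
    intro s hs i
    obtain ⟨u, hu, v, hv, rfl⟩ := Finset.mem_add.1 (MvPolynomial.support_mul _ _ hs)
    have h1 := apply_of_mem_support_rename (Fin.castAdd_injective d₁ d₂) ih₁ hu i
    have h2 := apply_of_mem_support_rename (Fin.natAdd_injective d₂ d₁) ih₂ hv i
    rw [Finsupp.add_apply]
    induction i using Fin.addCases with
    | left j =>
      rw [h2.2 (by rintro ⟨l, hl⟩; have := congrArg Fin.val hl; simp at this; omega)]
      exact h1.1
    | right j =>
      rw [h1.2 (by rintro ⟨l, hl⟩; have := congrArg Fin.val hl; simp at this; omega), zero_add]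
      exact h2.1
  | tensorX d f C c D h hc hD ih =>
    intro s hs i
    rcases Finset.mem_union.1 (MvPolynomial.support_add hs) with hs | hs
    · obtain ⟨u, hu, v, hv, rfl⟩ := Finset.mem_add.1 (MvPolynomial.support_mul _ _ hs)
      have h1 := apply_of_mem_support_rename (Fin.castSucc_injective d) ih hu i
      rw [MvPolynomial.support_X, Finset.mem_singleton] at hv
      subst hv
      rw [Finsupp.add_apply]
      induction i using Fin.lastCases with
      | last =>
        rw [h1.2 (by rintro ⟨l, hl⟩; exact (Fin.castSucc_lt_last l).ne hl)]
        simp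
      | cast j =>
        rw [Finsupp.single_eq_of_ne (Fin.castSucc_lt_last j).ne, add_zero]
        exact h1.1
    · have : s = 0 := by
        rw [MvPolynomial.mem_support_iff, MvPolynomial.coeff_C] at hs
        by_contra hne
        exact hs (if_neg (Ne.symm hne))
      simp [this]

/-- Every monomial other than the full one misses some variable and so loses a factor of at least `3
^ M`. The sum of the other coefficients serves as `K`. -/
theorem IsMultilinear.isLeadOn_leadCoeff {d : ℕ} {f : MvPolynomial (Fin d) ℕ}
    (hf : IsMultilinear f) (c : Fin d → ℕ) : IsLeadOn f Finset.univ c (leadCoeff f) := by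
  classical
  set s₀ : Fin d →₀ ℕ := Finsupp.equivFunOnFinite.symm (fun _ : Fin d => 1) with hs₀
  have hs₀' : ∀ i, s₀ i = 1 := fun i => rfl
  have hev : ∀ n, evalPowThree f n =
      ∑ s ∈ insert s₀ f.support, MvPolynomial.coeff s f * 3 ^ (∑ i, n i * s i) := by
    intro n
    rw [evalPowThree, MvPolynomial.eval_eq']
    rw [← Finset.sum_subset (Finset.subset_insert s₀ f.support)]
    · refine Finset.sum_congr rfl fun s _ => ?_
      rw [← Finset.prod_pow_eq_pow_sum]
      simp only [pow_mul]
    · intro s _ hs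
      rw [MvPolynomial.notMem_support_iff.1 hs, zero_mul]
  refine ⟨∑ s ∈ (insert s₀ f.support).erase s₀, MvPolynomial.coeff s f, fun n _ => ?_⟩
  have hsplit := Finset.add_sum_erase (insert s₀ f.support)
    (fun s => MvPolynomial.coeff s f * 3 ^ (∑ i, n i * s i)) (Finset.mem_insert_self _ _)
  rw [← hev] at hsplit
  simp only [hs₀', mul_one] at hsplit
  rw [← hsplit]
  refine ⟨Nat.le_add_right _ _, fun M hM => ?_⟩
  have hrest : ∀ s ∈ (insert s₀ f.support).erase s₀,
      MvPolynomial.coeff s f * 3 ^ (∑ i, n i * s i) * 3 ^ M ≤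
        MvPolynomial.coeff s f * 3 ^ (∑ i, n i) := by
    intro s hs
    obtain ⟨hne, hs⟩ := Finset.mem_erase.1 hs
    have hs1 := hf s (Finset.mem_of_mem_insert_of_ne hs hne)
    obtain ⟨j, hj⟩ : ∃ j, s j ≠ 1 := by
      by_contra! h
      exact hne (Finsupp.ext h)
    have hj0 : s j = 0 := by have := hs1 j; omega
    rw [mul_assoc, ← pow_add]
    refine Nat.mul_le_mul_left _ (Nat.pow_le_pow_right (by norm_num) ?_)
    rw [← Finset.add_sum_erase _ _ (Finset.mem_univ j), ← Finset.add_sum_erase _ n (Finset.mem_univ j),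
      hj0, mul_zero, zero_add, add_comm]
    refine Nat.add_le_add (hM j (Finset.mem_univ j)) (Finset.sum_le_sum fun i _ => ?_)
    exact (Nat.mul_le_mul_left _ (hs1 i)).trans_eq (mul_one _)
  rw [add_mul, add_mul, Finset.sum_mul, Finset.sum_mul]
  refine Nat.add_le_add (le_of_eq ?_) (Finset.sum_le_sum hrest)
  rw [leadCoeff]; ring

/-- Dividing by all the variables turns `f·x + c` into `f` over its variables plus `c` over all of
them, and both terms decrease. This makes the defect functions monotone. -/
theorem LowDefectPair.mul_three_pow_le {d : ℕ} {f : MvPolynomial (Fin d) ℕ} {C : ℕ}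
    (h : LowDefectPair d f C) {m n : Fin d → ℕ} (hmn : m ≤ n) :
    evalPowThree f n * 3 ^ (∑ i, m i) ≤ evalPowThree f m * 3 ^ (∑ i, n i) := by
  induction h with
  | const a C ha hC => rw [evalPowThree_C, evalPowThree_C]; simp
  | tensor d₁ d₂ f₁ f₂ C₁ C₂ h₁ h₂ ih₁ ih₂ =>
    simp only [Fin.sum_univ_add, evalPowThree_tensor, pow_add]
    exact (mul_mul_mul_comm _ _ _ _).trans_le ((Nat.mul_le_mul
      (ih₁ (m := fun i => m (Fin.castAdd d₂ i)) (n := fun i => n (Fin.castAdd d₂ i)) fun i => hmn _)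
      (ih₂ (m := fun i => m (Fin.natAdd d₁ i)) (n := fun i => n (Fin.natAdd d₁ i))
        fun i => hmn _)).trans_eq (mul_mul_mul_comm _ _ _ _))
  | tensorX d f C c D h hc hD ih =>
    simp only [Fin.sum_univ_castSucc, evalPowThree_tensorX, pow_add]
    have h1 := ih (m := fun i => m i.castSucc) (n := fun i => n i.castSucc) fun i => hmn _
    have h2 : 3 ^ (∑ i : Fin d, m i.castSucc) ≤ 3 ^ (∑ i : Fin d, n i.castSucc) :=
      Nat.pow_le_pow_right (by norm_num) (Finset.sum_le_sum fun i _ => hmn _)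
    have h3 : 3 ^ m (Fin.last d) ≤ 3 ^ n (Fin.last d) :=
      Nat.pow_le_pow_right (by norm_num) (hmn _)
    calc _ = evalPowThree f (fun i => n i.castSucc) * 3 ^ (∑ i : Fin d, m i.castSucc) *
          (3 ^ n (Fin.last d) * 3 ^ m (Fin.last d)) +
          c * (3 ^ (∑ i : Fin d, m i.castSucc) * 3 ^ m (Fin.last d)) := by ring
      _ ≤ _ := Nat.add_le_add (Nat.mul_le_mul_right _ h1)
          (Nat.mul_le_mul_left c (Nat.mul_le_mul h2 h3))
      _ = _ := by ring

/-! ### The defect function of a low-defect pair: monotonicity and supremum. -/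

/-- The upper bound `C + 3 Σ nᵢ - 3 log₃ f(3ⁿ)` for the defect of `f(3ⁿ)` that comes from `(f, C)`. -/
noncomputable def pairDefect {d : ℕ} (f : MvPolynomial (Fin d) ℕ) (C : ℕ) (n : Fin d → ℕ) : ℝ :=
  C + 3 * ((∑ i, n i : ℕ) : ℝ) - logThree (evalPowThree f n)

theorem polyDefect_eq {d : ℕ} (f : MvPolynomial (Fin d) ℕ) :
    polyDefect f = pairDefect f (polyCpx f) := rfl

theorem IsLeadOn.evalPowThree {d : ℕ} (f : MvPolynomial (Fin d) ℕ) (n : Fin d → ℕ) :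
    IsLeadOn f ∅ n (evalPowThree f n) := by
  refine ⟨0, fun n' hn' => ?_⟩
  obtain rfl : n' = n := funext fun i => hn' i (Finset.notMem_empty i)
  simp

namespace LowDefectPair

variable {d : ℕ} {f : MvPolynomial (Fin d) ℕ} {C : ℕ}

/-- With no free variables the leading coefficient is the value itself. -/
theorem cpx_evalPowThree_le (h : LowDefectPair d f C) (n : Fin d → ℕ) :
    cpx (evalPowThree f n) ≤ C + 3 * ∑ i, n i := by
  obtain ⟨b, -, hb, hl⟩ := h.exists_isLeadOn ∅ n
  have e : b = evalPowThree f n :=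
    le_antisymm (hl.le (IsLeadOn.evalPowThree f n)) ((IsLeadOn.evalPowThree f n).le hl)
  subst e
  simpa using hb

theorem monotone_pairDefect (h : LowDefectPair d f C) : Monotone (pairDefect f C) := by
  intro m n hmn
  have hm := h.evalPowThree_pos m
  have hn := h.evalPowThree_pos n
  have := logThree_le (by positivity) (h.mul_three_pow_le hmn)
  rw [logThree_mul hn (by positivity), logThree_mul hm (by positivity), logThree_three_pow,
    logThree_three_pow] at this
  simp only [pairDefect]
  linarith

/-- The estimate `f ≥ b · 3^Σ` gives the upper bound. At points with free exponents at least `M`, `f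
≤ (b + K/3^M) · 3^Σ`, and `M → ∞` shows that nothing smaller works. -/
theorem isLUB_pairDefect (h : LowDefectPair d f C) {J : Finset (Fin d)} {c : Fin d → ℕ} {b : ℕ}
    (hb : 0 < b) (hl : IsLeadOn f J c b) {X : Set (Fin d → ℕ)} (hX : FixedOff J c X)
    (hU : UnboundedOn J X) :
    IsLUB (pairDefect f C '' X) (C + 3 * ((∑ i ∈ Jᶜ, c i : ℕ) : ℝ) - logThree b) := by
  obtain ⟨K, hl⟩ := hl
  have hsum : ∀ n ∈ X, ((∑ i, n i : ℕ) : ℝ) =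
      ((∑ i ∈ J, n i : ℕ) : ℝ) + ((∑ i ∈ Jᶜ, c i : ℕ) : ℝ) := by
    intro n hn
    rw [← Nat.cast_add, ← Finset.sum_add_sum_compl J,
      Finset.sum_congr (s₁ := Jᶜ) rfl fun i hi => hX n hn i (Finset.mem_compl.1 hi)]
  refine ⟨?_, fun u hu => ?_⟩
  · rintro _ ⟨n, hn, rfl⟩
    have h1 := logThree_le (by positivity) (hl n (hX n hn)).1
    rw [logThree_mul hb (by positivity), logThree_three_pow] at h1
    rw [pairDefect, hsum n hn]
    linarith
  · have hlim : Filter.Tendsto (fun M : ℕ => 3 * Real.logb 3 (b + K * (1 / 3) ^ M)) Filter.atTop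
        (nhds (logThree b)) := by
      have hb' : (0 : ℝ) < b := by exact_mod_cast hb
      have h1 : Filter.Tendsto (fun M : ℕ => (b : ℝ) + K * (1 / 3) ^ M) Filter.atTop
          (nhds b) := by
        simpa using ((tendsto_pow_atTop_nhds_zero_of_lt_one (r := (1 / 3 : ℝ)) (by norm_num)
          (by norm_num)).const_mul (K : ℝ)).const_add (b : ℝ)
      exact (((Real.continuousAt_log hb'.ne').tendsto.comp h1).div_const _).const_mul 3
    have hbound : ∀ M : ℕ, C + 3 * ((∑ i ∈ Jᶜ, c i : ℕ) : ℝ) - u ≤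
        3 * Real.logb 3 (b + K * (1 / 3) ^ M) := by
      intro M
      obtain ⟨n, hn, hM⟩ := hU M
      have hn0 := h.evalPowThree_pos n
      have h1 := logThree_le (by positivity) ((hl n (hX n hn)).2 M hM)
      have e : logThree (b * 3 ^ M + K) = 3 * Real.logb 3 (b + K * (1 / 3) ^ M) + 3 * M := by
        have : ((b * 3 ^ M + K : ℕ) : ℝ) = (b + K * (1 / 3) ^ M) * 3 ^ M := by
          push_cast
          rw [add_mul, mul_assoc, ← mul_pow]
          norm_num
        rw [logThree, this, Real.logb_mul (by positivity) (by positivity), Real.logb_pow,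
          Real.logb_self_eq_one (by norm_num)]
        ring
      rw [logThree_mul hn0 (by positivity), logThree_mul (by positivity) (by positivity), e,
        logThree_three_pow, logThree_three_pow] at h1
      have h2 : pairDefect f C n ≤ u := hu ⟨n, hn, rfl⟩
      rw [pairDefect, hsum n hn] at h2
      linarith
    have := ge_of_tendsto' hlim hbound
    linarith

theorem leadCoeff_pos (h : LowDefectPair d f C) : 0 < leadCoeff f := by
  obtain ⟨b, hb, -, hl⟩ := h.exists_isLeadOn Finset.univ 0
  exact hb.trans_le (hl.le (h.isMultilinear.isLeadOn_leadCoeff 0))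

theorem pairDefect_le (h : LowDefectPair d f C) (n : Fin d → ℕ) :
    pairDefect f C n ≤ C - logThree (leadCoeff f) := by
  obtain ⟨K, hl⟩ := h.isMultilinear.isLeadOn_leadCoeff 0
  have h1 := logThree_le (Nat.mul_pos h.leadCoeff_pos (by positivity)) (hl n (by simp)).1
  rw [logThree_mul h.leadCoeff_pos (by positivity), logThree_three_pow] at h1
  rw [pairDefect]
  linarith

end LowDefectPair

theorem IsLowDefectPoly.lowDefectPair {d : ℕ} {f : MvPolynomial (Fin d) ℕ}
    (h : IsLowDefectPoly f) : LowDefectPair d f (polyCpx f) :=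
  Nat.sInf_mem h

theorem EfficientlyRepresents.exists_pairDefect {d : ℕ} {f : MvPolynomial (Fin d) ℕ} {C n : ℕ}
    (hf : LowDefectPair d f C) (h : EfficientlyRepresents d f C n) :
    ∃ m, defect n = pairDefect f C m := by
  obtain ⟨m, t, rfl, hc⟩ := h
  refine ⟨m, ?_⟩
  rw [defect_eq, hc, logThree_mul (by positivity) (hf.evalPowThree_pos m), logThree_three_pow,
    pairDefect]
  push_cast; ring

/-! ### Order types on the exceptional set. -/

theorem not_omegaPowLarge_polyDefect {k : ℕ} {f : MvPolynomial (Fin k) ℕ}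
    (hf : IsSubstantial f) : ¬ OmegaPowLarge k (polyDefect f '' exceptionalSet f) := by
  intro hbig
  have hp := hf.1.lowDefectPair
  have ha := hp.leadCoeff_pos
  set a := leadCoeff f with ha_def
  set r : ℝ := polyCpx f - logThree a + 1 with hr
  obtain ⟨G, hG, hGpair, hGrep⟩ := finitelyCovered_defectBelow r
  obtain ⟨B, hB⟩ := exists_nat_ge r
  have hcolor : ∀ n ∈ exceptionalSet f, ∃ q ∈ Set.Iic B ×ˢ G,
      0 < q.1 ∧ ∃ m, pairDefect q.2.2.1 q.2.2.2 m + q.1 = polyDefect f n := by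
    intro n hn
    have hpos := hp.evalPowThree_pos n
    have hle := hp.pairDefect_le n
    have hst := defectSt_eq hpos
    have hst0 := defectSt_nonneg hpos
    obtain ⟨j, hj⟩ := Int.eq_ofNat_of_zero_le (sub_nonneg.2 (le_of_lt hn))
    -- Membership in the exceptional set is exactly the positivity of this drop.
    have hj0 : 0 < j := by
      have : (0 : ℤ) < j := hj ▸ sub_pos.2 hn
      exact_mod_cast this
    have hj' : defectSt (evalPowThree f n) + j = polyDefect f n := by
      have : ((polyCpx f : ℤ) + 3 * ((∑ i, n i : ℕ) : ℤ) - cpxSt (evalPowThree f n) : ℝ) = j := by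
        exact_mod_cast hj
      rw [hst, polyDefect_eq, pairDefect]
      push_cast at this ⊢
      linarith
    rw [← polyDefect_eq, ← ha_def] at hle
    have hj1 : (0 : ℝ) < j := by exact_mod_cast hj0
    obtain ⟨q, hq, hrep⟩ := hGrep (3 ^ stabIndex (evalPowThree f n) * evalPowThree f n)
      ⟨by positivity, by rw [← defectSt]; linarith⟩
    obtain ⟨m, hm⟩ := hrep.exists_pairDefect (hGpair q hq)
    rw [← defectSt] at hm
    refine ⟨(j, q), ⟨?_, hq⟩, hj0, m, by rw [← hm]; exact hj'⟩
    have : (j : ℝ) ≤ B := by linarith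
    exact_mod_cast this
  obtain ⟨⟨j, d, g, C⟩, hq, hbig⟩ := hbig.exists_color ((Set.finite_Iic B).prod hG)
    (fun q n => 0 < q.1 ∧ ∃ m, pairDefect q.2.2.1 q.2.2.2 m + q.1 = polyDefect f n) hcolor
  have hg : LowDefectPair d g C := hGpair _ hq.2
  set φ : (Fin d → ℕ) → ℝ := fun m => pairDefect g C m + j with hφ
  have hφmono : Monotone φ := fun m n hmn => add_le_add_left (hg.monotone_pairDefect hmn) _
  obtain ⟨_, n₀, ⟨-, hj0, -⟩, -⟩ := hbig.nonempty
  replace hbig : OmegaPowLarge k (φ '' {m | ∃ n, φ m = polyDefect f n}) := by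
    refine hbig.mono ?_
    rintro _ ⟨n, ⟨-, -, m, hm⟩, rfl⟩
    exact ⟨m, ⟨n, hm⟩, hm⟩
  obtain ⟨J, c, Y, hYs, hYf, hYu, hbig⟩ := hbig.exists_unboundedOn (J := Finset.univ) (c := 0)
    (fun n _ i hi => absurd (Finset.mem_univ i) hi)
  have hJ := hbig.le_card hφmono hYf
  obtain ⟨b, hb, hcb, hbl⟩ := hg.exists_isLeadOn J c
  have hlub := hg.isLUB_pairDefect hb hbl hYf hYu
  set Cg : ℕ := C + 3 * ∑ i ∈ Jᶜ, c i with hCg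
  have hlub' : IsLUB (pairDefect g C '' Y) (Cg - logThree b) := by
    convert hlub using 2
    push_cast [hCg]; ring
  replace hbig : OmegaPowLarge k (polyDefect f '' {n | polyDefect f n ∈ φ '' Y}) := by
    refine hbig.mono ?_
    rintro _ ⟨m, hm, rfl⟩
    obtain ⟨n, hn⟩ := hYs hm
    exact ⟨n, ⟨m, hm, hn⟩, hn.symm⟩
  obtain ⟨J₂, c₂, X, hXs, hXf, hXu, hbig⟩ := hbig.exists_unboundedOn (J := Finset.univ) (c := 0)
    (fun n _ i hi => absurd (Finset.mem_univ i) hi)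
  have hJ₂ := hbig.le_card hp.monotone_pairDefect hXf
  -- Only `k` coordinates are available and `k` must be free, so no coordinate of `f` is fixed.
  obtain rfl : J₂ = Finset.univ := by
    rw [← Finset.card_eq_iff_eq_univ, Fintype.card_fin]
    exact le_antisymm (by simpa using Finset.card_le_univ J₂) hJ₂
  have hlubf := hp.isLUB_pairDefect ha (hp.isMultilinear.isLeadOn_leadCoeff c₂) hXf hXu
  simp only [Finset.compl_univ, Finset.sum_empty, Nat.cast_zero, mul_zero, add_zero] at hlubf
  have hle1 : (polyCpx f : ℝ) - logThree a ≤ Cg - logThree b + j := by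
    refine hlubf.2 ?_
    rintro _ ⟨n, hn, rfl⟩
    obtain ⟨m, hm, hmn⟩ := hXs hn
    rw [← polyDefect_eq, ← hmn]
    exact add_le_add_left (hlub'.1 ⟨m, hm, rfl⟩) _
  have hle2 : (Cg : ℝ) - logThree b ≤ polyCpx f - logThree a - j := by
    refine hlub'.2 ?_
    rintro _ ⟨m, hm, rfl⟩
    obtain ⟨n, hn⟩ := hYs hm
    have := hp.pairDefect_le n
    rw [← polyDefect_eq, ← hn] at this
    simp only [hφ] at this
    linarith
  -- Equality of the suprema makes `3 log₃ a - 3 log₃ b` an integer.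
  have hst : defectSt a = defectSt b := by
    refine defectSt_eq_of_logThree_sub ha hb (polyCpx f - Cg - j) ?_
    push_cast
    linarith
  rw [defectSt_eq ha, defectSt_eq hb] at hst
  have hsub : (polyCpx f : ℝ) = cpxSt a + k := by
    have := hf.2
    rw [hp.ne_zero_and_totalDegree.2] at this
    exact_mod_cast this
  have hCg' : (cpxSt b : ℝ) + k ≤ Cg := by
    have h1 := cpxSt_le_cpx hb
    have h2 : cpxSt b + (k : ℤ) ≤ (Cg : ℤ) := by omega
    exact_mod_cast h2
  have : (0 : ℝ) < j := by exact_mod_cast hj0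
  linarith

/-- A function that differs from `δ_f` by nonnegative integers and stays nonnegative takes values
of order type less than `ω ^ k` on the exceptional set. -/
theorem orderTypeLT_of_exists_drop {k : ℕ} {f : MvPolynomial (Fin k) ℕ} (hf : IsSubstantial f)
    {ψ : (Fin k → ℕ) → ℝ} (hψ : ∀ n, 0 ≤ ψ n) (h : ∀ n, ∃ j : ℕ, ψ n + j = polyDefect f n) :
    OrderTypeLT (ψ '' exceptionalSet f) (Ordinal.omega0 ^ (k : Ordinal.{0})) := by
  have hp := hf.1.lowDefectPair
  obtain ⟨B, hB⟩ := exists_nat_ge (polyCpx f - logThree (leadCoeff f))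
  have h' : ∀ n ∈ exceptionalSet f, ∃ j ∈ Set.Iic B, ψ n + j = polyDefect f n := by
    intro n _
    obtain ⟨j, hj⟩ := h n
    have h1 := hp.pairDefect_le n
    rw [← polyDefect_eq, ← hj] at h1
    have h2 := hψ n
    have : (j : ℝ) ≤ B := by linarith
    exact ⟨j, by exact_mod_cast this, hj⟩
  refine orderTypeLT_of_not_omegaPowLarge (Set.IsPWO.isWF ?_) fun hbig => ?_
  · have hpwo : (⋃ j ∈ Finset.Iic B, (fun n => polyDefect f n - j) '' Set.univ).IsPWO := by
      refine (Finset.isPWO_bUnion _).2 fun j _ => ?_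
      refine Set.IsPWO.image_of_monotone (Set.isPWO_of_wellQuasiOrderedLE _) ?_
      exact fun m n hmn => sub_le_sub_right (hp.monotone_pairDefect hmn) _
    refine hpwo.mono ?_
    rintro _ ⟨n, hn, rfl⟩
    obtain ⟨j, hj, e⟩ := h' n hn
    exact Set.mem_biUnion (s := (Finset.Iic B : Set ℕ)) (by simpa using hj) ⟨n, trivial, by simp [← e]⟩
  · obtain ⟨j, -, hj⟩ := hbig.exists_color (Set.finite_Iic B)
      (fun (j : ℕ) n => ψ n + j = polyDefect f n) h'
    refine not_omegaPowLarge_polyDefect hf ((hj.image_add j).mono ?_)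
    rintro _ ⟨_, ⟨n, ⟨hn, e⟩, rfl⟩, rfl⟩
    exact ⟨n, hn, e.symm⟩

theorem mainTheorem8 (k : ℕ) (f : MvPolynomial (Fin k) ℕ) (hf : IsSubstantial f) :
    OrderTypeLT (polyDefect f '' exceptionalSet f) (Ordinal.omega0 ^ (k : Ordinal.{0})) ∧
    OrderTypeLT ((fun n => defectSt (evalPowThree f n)) '' exceptionalSet f)
      (Ordinal.omega0 ^ (k : Ordinal.{0})) ∧
    OrderTypeLT ((fun n => defect (evalPowThree f n)) '' exceptionalSet f)
      (Ordinal.omega0 ^ (k : Ordinal.{0})) := by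
  have hp := hf.1.lowDefectPair
  have hdrop : ∀ n, ∃ j : ℕ, defect (evalPowThree f n) + j = polyDefect f n := fun n => by
    obtain ⟨j, hj⟩ := Nat.exists_eq_add_of_le (hp.cpx_evalPowThree_le n)
    have hj' : (polyCpx f : ℝ) + 3 * ((∑ i, n i : ℕ) : ℝ) = cpx (evalPowThree f n) + j := by
      exact_mod_cast hj
    exact ⟨j, by rw [polyDefect_eq, pairDefect, defect_eq, hj']; ring⟩
  have hdropSt : ∀ n, ∃ j : ℕ, defectSt (evalPowThree f n) + j = polyDefect f n := fun n => by
    obtain ⟨j, hj⟩ := hdrop n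
    obtain ⟨i, hi⟩ := Int.eq_ofNat_of_zero_le
      (sub_nonneg.2 (cpxSt_le_cpx (hp.evalPowThree_pos n)))
    have hi' : (cpx (evalPowThree f n) : ℝ) - cpxSt (evalPowThree f n) = i := by exact_mod_cast hi
    refine ⟨i + j, ?_⟩
    rw [← hj, defectSt_eq (hp.evalPowThree_pos n), defect_eq]
    push_cast
    linarith
  have hnn : ∀ n, 0 ≤ defect (evalPowThree f n) := fun n => defect_nonneg (hp.evalPowThree_pos n)
  refine ⟨orderTypeLT_of_exists_drop hf (fun n => ?_) fun n => ⟨0, by simp⟩,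
    orderTypeLT_of_exists_drop hf (fun n => defectSt_nonneg (hp.evalPowThree_pos n)) hdropSt,
    orderTypeLT_of_exists_drop hf hnn hdrop⟩
  obtain ⟨j, hj⟩ := hdrop n
  rw [← hj]
  exact add_nonneg (hnn n) (Nat.cast_nonneg j)
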